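/- Let $\langle k\rangle=(1+|k|^2)^{1/2}$ and, for $l\in\mathbb R$, let $\langle k\rangle^{-l}L^r$ be the space of (classes of) measurable $f:\mathbb R^3\to\mathbb R$ with norm $\|\langle k\rangle^{l}f\|_{L^r(\mathbb R^3)}<\infty$. Consider the 3D wave kinetic equation with Laplacian dispersion relation $$\partial_t f=\mathcal C[f],\qquad f(t=0)=f_0,\tag{WKE}$$ $$\mathcal C[f](k)=\int_{\mathbb R^9}\delta(k+k_1-k_2-k_3)\,\delta(|k|^2+|k_1|^2-|k_2|^2-|k_3|^2)\,\big(f_2f_3(f+f_1)-ff_1(f_2+f_3)\big)\,dk_1dk_2dk_3,$$ where $f=f(k)$, $f_i=f(k_i)$, and where the integral $\int\delta\,\delta\,F(k,k_1,k_2,k_3)\,dk_1dk_2dk_3$ is understood as $$\frac18\int_{\mathbb R^3\times\mathbb S^2}|k-k_1|\,F(k,k_1,k^*,k_1^*)\,d\sigma\,dk_1,\qquad k^*=\tfrac{k+k_1}{2}-\tfrac{|k-k_1|}{2}\sigma,\quad k_1^*=\tfrac{k+k_1}{2}+\tfrac{|k-k_1|}{2}\sigma .$$ Let $2\le r\le\infty$,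 with $0<\delta<1/r$ if $r<\infty$ and $\delta>0$ if $r=\infty$, and put $l=2-\frac3r+\delta$. A strong solution of (WKE) on $[0,T]$ is an $f\in C([0,T];\langle k\rangle^{-l}L^r)$ such that $f(t)=f_0+\int_0^t\mathcal C[f](s)\,ds$ for all $t\in[0,T]$; the integrals defining the gain part and the collision frequency of $\mathcal C[f(s)]$ converge absolutely for a.e. $k$, and the time integral is a Bochner integral in $\langle k\rangle^{-l}L^r$. There is a function $T:[0,\infty)\to(0,\infty)$, depending only on $r$ and $\delta$, such that the following holds. 1. (Existence and uniqueness) For every $f_0\in\langle k\rangle^{-l}L^r$, with $T_{f_0}:=T(\|\langle k\rangle^{l}f_0\|_{L^r})$, (WKE) has a unique strong solution in $C([0,T_{f_0}];\langle k\rangle^{-l}L^r)$. 2. (Continuous dependence) If $f_0,g_0\in\langle k\rangle^{-l}L^r$, and $f,g$ are the corresponding solutions on $[0,T_{f_0}]$ and $[0,T_{g_0}]$, then, with $T_{\min}=\min\{T_{f_0},T_{g_0}\}$, $$\sup_{t\in[0,T_{\min}]}\big\|\langle k\rangle^{l}\big(f(t)-g(t)\big)\big\|_{L^r}\le 2\big\|\langle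 k\rangle^{l}(f_0-g_0)\big\|_{L^r}.$$ 3. (Positivity) If $f_0\ge0$ a.e., then $f(t)\ge0$ a.e. for all $t\in[0,T_{f_0}]$. -/

import Mathlib

open MeasureTheory Set
open scoped ENNReal

noncomputable section

namespace WKE

/-- Wave numbers: `ℝ³` with its Euclidean norm. -/
abbrev R3 : Type := EuclideanSpace ℝ (Fin 3)

/-- The unit sphere `𝕊²`. -/
abbrev S2 : Type := Metric.sphere (0 : R3) 1

/-- The Japanese bracket `⟨k⟩ = (1 + |k|²)^{1/2}`. -/
def bracket (k : R3) : ℝ := Real.sqrt (1 + ‖k‖ ^ 2)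

theorem bracket_pos (k : R3) : 0 < bracket k :=
  Real.sqrt_pos.2 (by positivity)

theorem continuous_bracket_rpow (l : ℝ) : Continuous fun k : R3 => bracket k ^ l := by
  refine Continuous.rpow_const ?_ fun k => Or.inl (bracket_pos k).ne'
  unfold bracket
  fun_prop

/-! ### The weighted Lebesgue spaces `⟨k⟩^{-l} L^r` -/

/-- The linear space of (a.e. classes of) measurable functions `f` on `ℝ³` such that
`⟨k⟩^l f` lies in `L^r`. -/
def weightedSubmodule (l : ℝ) (r : ℝ≥0∞) : Submodule ℝ (R3 →ₘ[(volume : Measure R3)] ℝ) where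
  carrier := {f | MemLp (fun k => bracket k ^ l * f k) r volume}
  zero_mem' := by
    refine (memLp_congr_ae ?_).2 (MemLp.zero (ε := ℝ) (p := r) (μ := (volume : Measure R3)))
    filter_upwards [AEEqFun.coeFn_zero (α := R3) (β := ℝ) (μ := volume)] with k hk
    simp [hk]
  add_mem' := by
    intro f g hf hg
    refine (memLp_congr_ae ?_).2 (MemLp.add hf hg)
    filter_upwards [AEEqFun.coeFn_add f g] with k hk
    simp [hk, mul_add]
  smul_mem' := by
    intro c f hf
    refine (memLp_congr_ae ?_).2 (MemLp.const_smul hf c)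
    filter_upwards [AEEqFun.coeFn_smul c f] with k hk
    simp only [hk, Pi.smul_apply, smul_eq_mul]
    ring

/-- The weighted Lebesgue space `⟨k⟩^{-l} L^r(ℝ³)`. -/
def WeightedLp (l : ℝ) (r : ℝ≥0∞) : Type := weightedSubmodule l r

namespace WeightedLp

variable {l : ℝ} {r : ℝ≥0∞}

instance : AddCommGroup (WeightedLp l r) :=
  inferInstanceAs (AddCommGroup (weightedSubmodule l r))

instance : Module ℝ (WeightedLp l r) :=
  inferInstanceAs (Module ℝ (weightedSubmodule l r))

/-- An element of `⟨k⟩^{-l} L^r` is used as a function on `ℝ³` through a representative. -/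
instance : CoeFun (WeightedLp l r) fun _ => R3 → ℝ where
  coe f := (Subtype.val f : R3 →ₘ[(volume : Measure R3)] ℝ)

/-- The weighting map `f ↦ ⟨k⟩^l f` from `⟨k⟩^{-l} L^r` to `L^r`. -/
def weight : WeightedLp l r →ₗ[ℝ] Lp ℝ r (volume : Measure R3) where
  toFun f := MemLp.toLp (fun k => bracket k ^ l * f k) f.2
  map_add' f g := by
    refine Eq.trans ?_ (MemLp.toLp_add f.2 g.2)
    refine (MemLp.toLp_eq_toLp_iff _ _).2 ?_
    filter_upwards [AEEqFun.coeFn_add (Subtype.val f) (Subtype.val g)] with k hk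
    have h : (f + g) k = f k + g k := hk
    simp [h, mul_add]
  map_smul' c f := by
    refine Eq.trans ?_ (MemLp.toLp_const_smul c f.2)
    refine (MemLp.toLp_eq_toLp_iff _ _).2 ?_
    filter_upwards [AEEqFun.coeFn_smul c (Subtype.val f)] with k hk
    have h : (c • f) k = c * f k := hk
    simp only [h, Pi.smul_apply, smul_eq_mul]
    ring

theorem weight_coe_ae (f : WeightedLp l r) :
    (weight f : R3 → ℝ) =ᵐ[volume] fun k => bracket k ^ l * f k :=
  MemLp.coeFn_toLp f.2

theorem weight_injective : Function.Injective (weight (l := l) (r := r)) := by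
  intro f g h
  refine Subtype.ext (AEEqFun.ext ?_)
  filter_upwards [(MemLp.toLp_eq_toLp_iff f.2 g.2).1 h] with k hk
  exact mul_left_cancel₀ (Real.rpow_pos_of_pos (bracket_pos k) l).ne' hk

theorem weight_surjective : Function.Surjective (weight (l := l) (r := r)) := by
  intro F
  have hm : AEStronglyMeasurable (fun k => bracket k ^ (-l) * F k) (volume : Measure R3) :=
    (continuous_bracket_rpow (-l)).aestronglyMeasurable.mul (Lp.aestronglyMeasurable F)
  have key : (fun k => bracket k ^ l * AEEqFun.mk _ hm k) =ᵐ[volume] F := by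
    filter_upwards [AEEqFun.coeFn_mk _ hm] with k hk
    rw [hk, ← mul_assoc, ← Real.rpow_add (bracket_pos k)]
    simp
  have hmem : MemLp (fun k => bracket k ^ l * AEEqFun.mk _ hm k) r volume :=
    (memLp_congr_ae key).2 (Lp.memLp F)
  refine ⟨⟨AEEqFun.mk _ hm, hmem⟩, ?_⟩
  refine Lp.ext ?_
  exact (weight_coe_ae ⟨AEEqFun.mk _ hm, hmem⟩).trans key

/-- The norm of `⟨k⟩^{-l} L^r` is `‖f‖ = ‖⟨k⟩^l f‖_{L^r}`. -/
instance [Fact (1 ≤ r)] : NormedAddCommGroup (WeightedLp l r) :=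
  NormedAddCommGroup.induced (WeightedLp l r) (Lp ℝ r (volume : Measure R3)) weight
    weight_injective

theorem norm_eq [Fact (1 ≤ r)] (f : WeightedLp l r) :
    ‖f‖ = (eLpNorm (fun k => bracket k ^ l * f k) r volume).toReal :=
  Lp.norm_toLp _ f.2

instance [Fact (1 ≤ r)] : NormedSpace ℝ (WeightedLp l r) where
  norm_smul_le c f := by
    change ‖weight (c • f)‖ ≤ ‖c‖ * ‖weight f‖
    rw [map_smul, norm_smul]

instance [Fact (1 ≤ r)] : CompleteSpace (WeightedLp l r) := by
  have hi : Isometry (weight (l := l) (r := r)) :=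
    AddMonoidHomClass.isometry_of_norm weight fun _ => rfl
  rw [completeSpace_iff_isComplete_univ, ← hi.isUniformInducing.isComplete_iff,
    image_univ, weight_surjective.range_eq]
  exact isComplete_univ

end WeightedLp

/-! ### The collision operator -/

/-- `k^* = K - (|w|/2) σ`, where `K = (k + k₁)/2` and `w = k - k₁`. -/
def kStar (k k₁ : R3) (σ : S2) : R3 :=
  (1 / 2 : ℝ) • (k + k₁) - (‖k - k₁‖ / 2) • (σ : R3)

/-- `k₁^* = K + (|w|/2) σ`, where `K = (k + k₁)/2` and `w = k - k₁`. -/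
def kOneStar (k k₁ : R3) (σ : S2) : R3 :=
  (1 / 2 : ℝ) • (k + k₁) + (‖k - k₁‖ / 2) • (σ : R3)

/-- Lebesgue measure in `k₁` times the surface measure in `σ` on `ℝ³ × 𝕊²`. -/
def resonantMeasure : Measure (R3 × S2) :=
  (volume : Measure R3).prod (volume : Measure R3).toSphere

/-- The integrand `|w| F(k, k₁, k^*, k₁^*)`. -/
def resonantIntegrand (F : R3 → R3 → R3 → R3 → ℝ) (k : R3) (p : R3 × S2) : ℝ :=
  ‖k - p.1‖ * F k p.1 (kStar k p.1 p.2) (kOneStar k p.1 p.2)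

/-- The integral `∫ δ(Σ) δ(Ω) F(k, k₁, k₂, k₃) dk₁ dk₂ dk₃` over the resonant manifold
`k + k₁ = k₂ + k₃`, `|k|² + |k₁|² = |k₂|² + |k₃|²`; integrating out the two delta functions
turns it into `(1/8) ∫ |w| F(k, k₁, k^*, k₁^*) dσ dk₁` over `ℝ³ × 𝕊²`. -/
def resonantIntegral (F : R3 → R3 → R3 → R3 → ℝ) (k : R3) : ℝ :=
  1 / 8 * ∫ p, resonantIntegrand F k p ∂resonantMeasure

/-- The gain density `f₂ f₃ (f + f₁)`. -/
def gainDensity (f : R3 → ℝ) (k k₁ k₂ k₃ : R3) : ℝ := f k₂ * f k₃ * (f k + f k₁)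

/-- The density `f₁ (f₂ + f₃)` of the collision frequency. -/
def frequencyDensity (f : R3 → ℝ) (_k k₁ k₂ k₃ : R3) : ℝ := f k₁ * (f k₂ + f k₃)

/-- The gain operator `𝒬⁺[f]`. -/
def gain (f : R3 → ℝ) (k : R3) : ℝ := resonantIntegral (gainDensity f) k

/-- The collision frequency `ℛ[f]`. -/
def collisionFrequency (f : R3 → ℝ) (k : R3) : ℝ := resonantIntegral (frequencyDensity f) k

/-- The collision operator `𝒞[f] = 𝒬⁺[f] - f ℛ[f]`, that is, the resonant integral of
`f f₁ f₂ f₃ (1/f + 1/f₁ - 1/f₂ - 1/f₃) = f₂ f₃ (f + f₁) - f f₁ (f₂ + f₃)`. -/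
def collision (f : R3 → ℝ) (k : R3) : ℝ := gain f k - f k * collisionFrequency f k

/-- For almost every `k`, the integrals defining `𝒞[f](k)` converge absolutely. -/
def CollisionConverges (f : R3 → ℝ) : Prop :=
  ∀ᵐ k : R3, Integrable (resonantIntegrand (gainDensity f) k) resonantMeasure ∧
    Integrable (resonantIntegrand (frequencyDensity f) k) resonantMeasure

/-! ### Strong solutions -/

/-- `f` is a strong solution on `[0,T]` of `∂ₜ f = 𝒞[f]`, `f(0) = f₀`, in `⟨k⟩^{-l} L^r`:
it is continuous on `[0,T]` with values in this space, `𝒞[f(s)]` is given by convergent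
integrals and lies in this space for every `s ∈ [0,T]`, it is integrable in time, and
`f(t) = f₀ + ∫₀ᵗ 𝒞[f](s) ds` for all `t ∈ [0,T]`. The values of `f` outside `[0,T]` are
irrelevant. -/
structure IsStrongSolution {l : ℝ} {r : ℝ≥0∞} [Fact (1 ≤ r)] (T : ℝ) (f₀ : WeightedLp l r)
    (f : ℝ → WeightedLp l r) : Prop where
  continuousOn : ContinuousOn f (Icc 0 T)
  converges : ∀ s ∈ Icc 0 T, CollisionConverges (f s)
  integral_eq : ∃ c : ℝ → WeightedLp l r,
    (∀ s ∈ Icc 0 T, (c s : R3 → ℝ) =ᵐ[volume] collision (f s)) ∧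
    IntervalIntegrable c volume 0 T ∧
    ∀ t ∈ Icc 0 T, f t = f₀ + ∫ s in (0 : ℝ)..t, c s

/-- The exponent `l = 2 - 3/r + δ`, with `3/r = 0` for `r = ∞`. -/
def weightExponent (r : ℝ≥0∞) (δ : ℝ) : ℝ := 2 - 3 * (r⁻¹).toReal + δ

end WKE

end

/-!
The collision operator is the restriction to the diagonal of a trilinear operator, and the whole
theory follows once this operator is bounded on `⟨k⟩^{-l} L^r`: the equation is then an ordinary
differential equation with a locally Lipschitz vector field.

*Uniform bounds.* With `m = (1 + δ)/2 > 1/2`, Hölder's inequality embeds `⟨k⟩^{-l} L^r` into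
`⟨k⟩^{-m} L²` (`exists_weightedL2_le`; this is where the value `l = 2 - 3/r + δ` enters). In the
latter space the integrals of `|w| f(k₁) g(k^*)`, `|w| f(k₁) g(k₁^*)` and `|w| f(k^*) g(k₁^*)` over
`ℝ³ × 𝕊²` are bounded uniformly in `k`. Indeed, by the Cauchy-Schwarz inequality with the
weights `|x|⁻¹ ⟨k + x⟩^{-2m}`, where `x` is the displacement from `k` of one of the two
wave numbers involved, they are controlled by integrals of such a weight over two-dimensional
surfaces: the sphere with diameter `[k, k₁]` on which `k^*` runs when `k₁` is fixed, and the plane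
through `k^*` (or `k`) orthogonal to `k^* - k` on which `k₁` (or `k₁^*`) runs when `k^*` is fixed.
On such surfaces, discs of radius `R` have area `O(R²)` whatever their centres, which suffices
for a bound on the integral of the weight that does not depend on `k`
(`lintegral_le_of_growth`). The planes appear after the change of variables `k₁ ↦ k^*` for a fixed
direction `σ` (`lintegral_aMap_le`), and their area measure is the image, under the gnomonic
projection, of the surface measure of a hemisphere with density `(θ ⬝ σ)⁻³` (`gnomonic_growth`).

*The trilinear estimate.* The terms of the collision operator that contain `f(k)` are the product
of `f` with a bounded function. The remaining one, `∫ |w| f(k₁) g(k^*) h(k₁^*)`, is a positive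
linear operator in `g` that is bounded on `L^∞` by the uniform bounds, and on `L¹` by the same
bounds after exchanging pre- and post-collisional variables (`lintegral_collision_swap`);
interpolation gives `L^r` (`eLpNorm_positive_operator_le`). Conservation of energy implies
`⟨k⟩^l ≤ 2^l (⟨k^*⟩^l + ⟨k₁^*⟩^l)`, which distributes the weight (`weightedNorm_gainPart_le`).

*The Cauchy problem.* Existence is the Picard-Lindelöf theorem, uniqueness and continuous
dependence are Grönwall's inequality. The nonnegative functions form a closed set that a short
explicit Euler step does not leave, because the collision frequency is bounded; by Nagumo's
argument such a set is invariant under the flow (`IsIntegralSolution.mem_of_euler_step_mem`).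
-/

noncomputable section

namespace WKE

/-! ### The area of caps and of gnomonic images of hemispheres -/

/-- The surface measure of the unit sphere `𝕊²`. -/
abbrev surf : Measure S2 := (volume : Measure R3).toSphere

/-- Integration in polar coordinates. -/
theorem lintegral_polar {F : R3 → ℝ≥0∞} (hF : Measurable F) :
    ∫⁻ x, F x =
      ∫⁻ σ, (∫⁻ t in Ioi (0 : ℝ), ENNReal.ofReal (t ^ 2) * F (t • (σ : R3))) ∂surf := by
  have hmp := (volume : Measure R3).measurePreserving_homeomorphUnitSphereProd
  have h0 : ∫⁻ x, F x = ∫⁻ x : ({0}ᶜ : Set R3), F (x : R3) ∂(Measure.comap Subtype.val volume) := by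
    rw [lintegral_subtype_comap (measurableSet_singleton _).compl,
      Measure.restrict_eq_self_of_ae_mem (s := ({0}ᶜ : Set R3))
        (compl_mem_ae_iff.2 (measure_singleton _))]
  have hG : Measurable fun q : S2 × Ioi (0 : ℝ) => F ((q.2 : ℝ) • (q.1 : R3)) := by
    refine hF.comp ?_
    fun_prop
  have h1 := hmp.lintegral_comp hG
  have h2 : ∀ x : ({0}ᶜ : Set R3),
      F (((homeomorphUnitSphereProd R3 x).2 : ℝ) • ((homeomorphUnitSphereProd R3 x).1 : R3)) = F x := by
    intro x
    congr 1
    exact congrArg Subtype.val ((homeomorphUnitSphereProd R3).symm_apply_apply x)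
  simp only [h2] at h1
  rw [h0, h1, lintegral_prod _ hG.aemeasurable]
  refine lintegral_congr fun σ => ?_
  have hd : Module.finrank ℝ R3 - 1 = 2 := by simp
  rw [Measure.volumeIoiPow, hd, lintegral_withDensity_eq_lintegral_mul _ (by fun_prop)
    (by fun_prop)]
  have := lintegral_subtype_comap (μ := (volume : Measure ℝ)) (s := Ioi (0 : ℝ)) measurableSet_Ioi
    (fun t : ℝ => ENNReal.ofReal (t ^ 2) * F (t • (σ : R3)))
  rw [← this]
  rfl

open scoped Pointwise in
theorem measurePreserving_neg_surf : MeasurePreserving (fun σ : S2 => -σ) surf surf := by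
  refine ⟨by fun_prop, ?_⟩
  ext s hs
  have hs' : MeasurableSet ((fun σ : S2 => -σ) ⁻¹' s) := hs.preimage (by fun_prop)
  rw [Measure.map_apply (by fun_prop) hs, Measure.toSphere_apply' _ hs', Measure.toSphere_apply' _ hs]
  congr 1
  rw [← Measure.measure_neg (volume : Measure R3) (Ioo (0 : ℝ) 1 • (Subtype.val '' s))]
  congr 1
  ext x
  simp only [Set.mem_smul, Set.mem_neg, mem_image, mem_preimage]
  constructor
  · rintro ⟨t, ht, _, ⟨σ, hσ, rfl⟩, rfl⟩
    exact ⟨t, ht, _, ⟨_, hσ, rfl⟩, by simp⟩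
  · rintro ⟨t, ht, _, ⟨σ, hσ, rfl⟩, h⟩
    exact ⟨t, ht, _, ⟨-σ, by simpa using hσ, rfl⟩, by simp [h]⟩

/-- A cylinder with axis `θ`, height `β - α` and radius `R` fits into a box. -/
theorem volume_cylinder_le (θ : R3) (hθ : ‖θ‖ = 1) (α β R : ℝ) :
    volume {x : R3 | inner ℝ θ x ∈ Icc α β ∧ ‖x - (inner ℝ θ x : ℝ) • θ‖ ≤ R} ≤
      ENNReal.ofReal (β - α) * ENNReal.ofReal (2 * R) ^ 2 := by
  obtain ⟨b, hb⟩ : ∃ b : OrthonormalBasis (Fin 3) ℝ R3, ∀ i ∈ ({0} : Set (Fin 3)), b i = (fun _ => θ) i := by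
    refine Orthonormal.exists_orthonormalBasis_extension_of_card_eq (by simp) ?_
    refine ⟨fun i => hθ, ?_⟩
    intro i j hij
    exact absurd (Subtype.ext (i.2.trans j.2.symm)) hij
  have hb0 : b 0 = θ := hb 0 rfl
  have hmp := (EuclideanSpace.volume_preserving_symm_measurableEquiv_toLp (Fin 3)).comp b.measurePreserving_repr
  let lo : Fin 3 → ℝ := ![α, -R, -R]
  let hi : Fin 3 → ℝ := ![β, R, R]
  have hbox : volume (Icc lo hi) = ENNReal.ofReal (β - α) * ENNReal.ofReal (2 * R) ^ 2 := by
    rw [Real.volume_Icc_pi]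
    simp [Fin.prod_univ_three, lo, hi, sq, two_mul, mul_assoc]
  rw [← hbox, ← hmp.measure_preimage measurableSet_Icc.nullMeasurableSet]
  refine measure_mono ?_
  rintro x ⟨hx, hR⟩
  have key : ∀ i : Fin 3, i ≠ 0 → |inner ℝ (b i) x| ≤ R := by
    intro i hi
    have h1 : inner ℝ (b i) x = inner ℝ (b i) (x - (inner ℝ θ x : ℝ) • θ) := by
      rw [inner_sub_right, inner_smul_right, ← hb0, b.orthonormal.2 hi]; simp
    rw [h1]
    refine (abs_real_inner_le_norm _ _).trans ?_
    rw [b.orthonormal.1 i, one_mul]; exact hR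
  have h0 : inner ℝ (b 0) x = inner ℝ θ x := by rw [hb0]
  have k1 := abs_le.1 (key 1 (by decide))
  have k2 := abs_le.1 (key 2 (by decide))
  simp only [mem_preimage, Function.comp_apply, mem_Icc, Pi.le_def]
  constructor <;> intro i <;> fin_cases i <;>
    simp [lo, hi, OrthonormalBasis.repr_apply_apply, h0, hx.1, hx.2, k1, k2]

theorem abs_inner_le_one {θ σ : R3} (hθ : ‖θ‖ = 1) (hσ : ‖σ‖ = 1) : |(inner ℝ θ σ : ℝ)| ≤ 1 := by
  simpa [hθ, hσ] using abs_real_inner_le_norm θ σ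

open scoped Pointwise in
/-- The surface measure of spherical caps grows quadratically. -/
theorem surf_cap_le (p : R3) (η : ℝ) :
    surf {σ : S2 | ‖(σ : R3) - p‖ ≤ η} ≤ 384 * ENNReal.ofReal (η ^ 2) := by
  rcases Set.eq_empty_or_nonempty {σ : S2 | ‖(σ : R3) - p‖ ≤ η} with h | ⟨σ₀, hσ₀⟩
  · simp [h]
  have hη : 0 ≤ η := (norm_nonneg _).trans hσ₀
  have hm : MeasurableSet {σ : S2 | ‖(σ : R3) - p‖ ≤ η} :=
    measurableSet_le (by fun_prop) measurable_const
  have h1 : ‖(σ₀ : R3)‖ = 1 := norm_eq_of_mem_sphere σ₀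
  rw [Measure.toSphere_apply' _ hm]
  -- The cone over the cap lies in a cylinder around the direction of one of its points `σ₀`.
  have hsub : Ioo (0 : ℝ) 1 • (Subtype.val '' {σ : S2 | ‖(σ : R3) - p‖ ≤ η}) ⊆
      {x : R3 | inner ℝ (σ₀ : R3) x ∈ Icc (-1 : ℝ) 1 ∧
        ‖x - (inner ℝ (σ₀ : R3) x : ℝ) • (σ₀ : R3)‖ ≤ 4 * η} := by
    rintro _ ⟨t, ht, _, ⟨σ, hσ, rfl⟩, rfl⟩
    have h2 : ‖(σ : R3)‖ = 1 := norm_eq_of_mem_sphere σ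
    have hd : ‖(σ : R3) - σ₀‖ ≤ 2 * η := by
      have := norm_sub_le ((σ : R3) - p) ((σ₀ : R3) - p)
      rw [sub_sub_sub_cancel_right] at this
      have e1 : ‖(σ : R3) - p‖ ≤ η := hσ
      have e2 : ‖(σ₀ : R3) - p‖ ≤ η := hσ₀
      linarith
    have hc := abs_le.1 (abs_inner_le_one h1 h2)
    have hs : inner ℝ (σ₀ : R3) (t • (σ : R3)) = t * inner ℝ (σ₀ : R3) (σ : R3) := inner_smul_right _ _ _
    simp only [mem_ofPred_eq, hs]
    refine ⟨⟨by nlinarith [ht.1, ht.2], by nlinarith [ht.1, ht.2]⟩, ?_⟩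
    have hone : 1 - (inner ℝ (σ₀ : R3) (σ : R3) : ℝ) = inner ℝ (σ₀ : R3) ((σ₀ : R3) - σ) := by
      rw [inner_sub_right, real_inner_self_eq_norm_sq, h1]; norm_num
    have hone' : |1 - (inner ℝ (σ₀ : R3) (σ : R3) : ℝ)| ≤ 2 * η := by
      rw [hone]
      refine (abs_real_inner_le_norm _ _).trans ?_
      rw [h1, one_mul, norm_sub_rev]; exact hd
    have heq : t • (σ : R3) - (t * inner ℝ (σ₀ : R3) (σ : R3)) • (σ₀ : R3) =
        t • (((σ : R3) - σ₀) + (1 - (inner ℝ (σ₀ : R3) (σ : R3) : ℝ)) • (σ₀ : R3)) := by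
      module
    rw [heq, norm_smul, Real.norm_of_nonneg ht.1.le]
    have hn := norm_add_le ((σ : R3) - σ₀) ((1 - (inner ℝ (σ₀ : R3) (σ : R3) : ℝ)) • (σ₀ : R3))
    rw [norm_smul, h1, mul_one, Real.norm_eq_abs] at hn
    nlinarith [ht.1, ht.2, norm_nonneg (((σ : R3) - σ₀) + (1 - (inner ℝ (σ₀ : R3) (σ : R3) : ℝ)) • (σ₀ : R3))]
  have := (measure_mono hsub).trans (volume_cylinder_le (σ₀ : R3) h1 (-1) 1 (4 * η))
  have hd : (Module.finrank ℝ R3 : ℝ≥0∞) = ENNReal.ofReal 3 := by simp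
  rw [hd]
  refine (mul_le_mul_right this _).trans_eq ?_
  rw [← ENNReal.ofReal_pow (by positivity), ← ENNReal.ofReal_mul (by norm_num),
    ← ENNReal.ofReal_mul (by norm_num), show (384 : ℝ≥0∞) = ENNReal.ofReal 384 by norm_num,
    ← ENNReal.ofReal_mul (by norm_num)]
  congr 1; ring

/-- A slanted cylinder with axis `p`, normalized by `θ ⬝ p = 1`, has the volume of the straight
cylinder onto which a transvection maps it. -/
theorem volume_slab_le (θ p : R3) (hθ : ‖θ‖ = 1) (hp : inner ℝ θ p = (1 : ℝ)) (R : ℝ) :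
    volume {x : R3 | inner ℝ θ x ∈ Icc (1 : ℝ) 2 ∧ ‖x - (inner ℝ θ x : ℝ) • p‖ ≤ R} ≤
      ENNReal.ofReal (2 * R) ^ 2 := by
  let L : R3 →ₗ[ℝ] R3 := LinearMap.transvection (innerSL ℝ θ).toLinearMap (θ - p)
  have hLx : ∀ x, L x = x + (inner ℝ θ x : ℝ) • (θ - p) := fun x => rfl
  have hθp : inner ℝ θ (θ - p) = (0 : ℝ) := by
    rw [inner_sub_right, real_inner_self_eq_norm_sq, hθ, hp]; norm_num
  have hdet : LinearMap.det L = 1 := by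
    have := LinearMap.transvection.det (innerSL ℝ θ).toLinearMap (θ - p)
    rw [this]
    simpa using hθp
  have hin : ∀ x, inner ℝ θ (L x) = (inner ℝ θ x : ℝ) := by
    intro x; rw [hLx, inner_add_right, inner_smul_right, hθp]; ring
  have h := volume_cylinder_le θ hθ 1 2 R
  rw [show ENNReal.ofReal (2 - 1) = 1 by norm_num, one_mul] at h
  have hpre := Measure.addHaar_preimage_linearMap (volume : Measure R3) (f := L) (by rw [hdet]; norm_num)
    {x : R3 | inner ℝ θ x ∈ Icc (1 : ℝ) 2 ∧ ‖x - (inner ℝ θ x : ℝ) • θ‖ ≤ R}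
  rw [hdet] at hpre
  simp only [inv_one, abs_one, ENNReal.ofReal_one, one_mul] at hpre
  refine le_trans ?_ h
  rw [← hpre]
  refine measure_mono ?_
  rintro x ⟨hx, hR⟩
  simp only [mem_preimage, mem_ofPred_eq, hin]
  refine ⟨hx, ?_⟩
  convert hR using 2
  rw [hLx]; module

/-- Under the gnomonic projection `σ ↦ σ / (θ ⬝ σ)` of a hemisphere onto the tangent plane, the
surface measure with density `(θ ⬝ σ)⁻³` grows quadratically. The cone over the preimage of a
disc, cut off by `1 ≤ θ ⬝ x ≤ 2`, lies in a slanted cylinder of height `1` and comparable radius,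
and `(θ ⬝ σ)⁻³` is at most the integral of `t²` over the part of the ray through `σ` in it. -/
theorem gnomonic_growth (θ p : R3) (hθ : ‖θ‖ = 1) (R : ℝ) :
    ∫⁻ σ : S2 in {σ : S2 | 0 < (inner ℝ θ (σ : R3) : ℝ) ∧
        ‖(inner ℝ θ (σ : R3) : ℝ)⁻¹ • (σ : R3) - p‖ ≤ R},
      ENNReal.ofReal ((inner ℝ θ (σ : R3) : ℝ)⁻¹ ^ 3) ∂surf ≤ 64 * ENNReal.ofReal (R ^ 2) := by
  set A := {σ : S2 | 0 < (inner ℝ θ (σ : R3) : ℝ) ∧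
        ‖(inner ℝ θ (σ : R3) : ℝ)⁻¹ • (σ : R3) - p‖ ≤ R} with hA
  rcases Set.eq_empty_or_nonempty A with h | ⟨σ₀, hσ₀⟩
  · simp [h]
  have hR : 0 ≤ R := (norm_nonneg _).trans hσ₀.2
  have hcm : Measurable fun σ : S2 => (inner ℝ θ (σ : R3) : ℝ) := by fun_prop
  have hAm : MeasurableSet A := by
    have h2 : Measurable fun σ : S2 => ‖(inner ℝ θ (σ : R3) : ℝ)⁻¹ • (σ : R3) - p‖ :=
      ((hcm.inv.smul measurable_subtype_coe).sub_const p).norm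
    exact (measurableSet_lt measurable_const hcm).inter (measurableSet_le h2 measurable_const)
  -- The slab is built around a point `p₀` of the image, as `p` need not lie in the tangent plane.
  set p₀ : R3 := (inner ℝ θ (σ₀ : R3) : ℝ)⁻¹ • (σ₀ : R3) with hp₀
  have hθp : inner ℝ θ p₀ = (1 : ℝ) := by
    rw [hp₀, inner_smul_right, inv_mul_cancel₀ hσ₀.1.ne']
  set S := {x : R3 | inner ℝ θ x ∈ Icc (1 : ℝ) 2 ∧ ‖x - (inner ℝ θ x : ℝ) • p₀‖ ≤ 4 * R} with hS
  have hSm : MeasurableSet S := by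
    have h1 : Measurable fun x : R3 => (inner ℝ θ x : ℝ) := by fun_prop
    have h2 : Measurable fun x : R3 => ‖x - (inner ℝ θ x : ℝ) • p₀‖ := by fun_prop
    exact (measurableSet_Icc.preimage h1).inter (measurableSet_le h2 measurable_const)
  have hvol := volume_slab_le θ p₀ hθ hθp (4 * R)
  have hfin : ENNReal.ofReal (2 * (4 * R)) ^ 2 = 64 * ENNReal.ofReal (R ^ 2) := by
    rw [← ENNReal.ofReal_pow (by positivity)]
    rw [show (64 : ℝ≥0∞) = ENNReal.ofReal 64 by norm_num, ← ENNReal.ofReal_mul (by norm_num)]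
    congr 1; ring
  rw [← hfin]
  refine le_trans ?_ hvol
  rw [← lintegral_indicator_one hSm, lintegral_polar (measurable_one.indicator hSm),
    ← lintegral_indicator hAm]
  refine lintegral_mono fun σ => ?_
  by_cases hσ : σ ∈ A
  swap
  · simp [hσ]
  rw [indicator_of_mem hσ]
  set c : ℝ := inner ℝ θ (σ : R3) with hc
  have hcpos : 0 < c := hσ.1
  have hd : ‖c⁻¹ • (σ : R3) - p₀‖ ≤ 2 * R := by
    have := norm_sub_le (c⁻¹ • (σ : R3) - p) (p₀ - p)
    rw [sub_sub_sub_cancel_right] at this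
    have e1 := hσ.2
    have e2 := hσ₀.2
    linarith
  have hmem : ∀ t ∈ Icc c⁻¹ (2 * c⁻¹), t • (σ : R3) ∈ S := by
    intro t ht
    have h1 : inner ℝ θ (t • (σ : R3)) = t * c := inner_smul_right _ _ _
    have htc : t * c ∈ Icc (1 : ℝ) 2 := by
      constructor
      · calc (1 : ℝ) = c⁻¹ * c := (inv_mul_cancel₀ hcpos.ne').symm
          _ ≤ t * c := by gcongr; exact ht.1
      · calc t * c ≤ 2 * c⁻¹ * c := by gcongr; exact ht.2
          _ = 2 := by field_simp
    refine ⟨by rw [h1]; exact htc, ?_⟩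
    rw [h1]
    have : t • (σ : R3) - (t * c) • p₀ = (t * c) • (c⁻¹ • (σ : R3) - p₀) := by
      rw [smul_sub, smul_smul (t * c) c⁻¹, mul_assoc t c c⁻¹, mul_inv_cancel₀ hcpos.ne', mul_one]
    rw [this, norm_smul, Real.norm_of_nonneg (by linarith [htc.1])]
    nlinarith [htc.1, htc.2, norm_nonneg (c⁻¹ • (σ : R3) - p₀)]
  calc ENNReal.ofReal (c⁻¹ ^ 3) = ∫⁻ t in Icc c⁻¹ (2 * c⁻¹), ENNReal.ofReal (c⁻¹ ^ 2) := by
        rw [setLIntegral_const, Real.volume_Icc, ← ENNReal.ofReal_mul (by positivity)]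
        congr 1; ring
    _ ≤ ∫⁻ t in Icc c⁻¹ (2 * c⁻¹), ENNReal.ofReal (t ^ 2) * S.indicator 1 (t • (σ : R3)) := by
        refine setLIntegral_mono' measurableSet_Icc fun t ht => ?_
        rw [indicator_of_mem (hmem t ht), Pi.one_apply, mul_one]
        have : 0 < c⁻¹ := by positivity
        gcongr
        exact ht.1
    _ ≤ _ := by
        refine lintegral_mono_set fun t ht => ?_
        exact lt_of_lt_of_le (by positivity) ht.1

/-! ### Integrals of the singular weight -/

theorem one_le_bracket (k : R3) : 1 ≤ bracket k := by
  unfold bracket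
  exact Real.one_le_sqrt.2 (by nlinarith [norm_nonneg k])

theorem norm_le_bracket (k : R3) : ‖k‖ ≤ bracket k := by
  unfold bracket
  exact Real.le_sqrt_of_sq_le (by linarith)

theorem continuous_bracket : Continuous bracket := by
  unfold bracket
  fun_prop

/-- The constant in `lintegral_le_of_growth`: up to a factor, the integrand bounds the measure of
the superlevel set of the weight at height `t`, by `t⁻²` for large `t`, and for small `t` by
`2 t^{-2/(1+2m)}`, which is integrable at `0` exactly if `m > 1/2`. -/
def growthConst (m : ℝ) : ℝ≥0∞ :=
  ∫⁻ t in Ioi (0 : ℝ), ENNReal.ofReal (min ((t⁻¹) ^ 2) (2 * (t ^ (-(1 + 2 * m)⁻¹)) ^ 2))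

theorem growthConst_ne_top {m : ℝ} (hm : 1 / 2 < m) : growthConst m ≠ ∞ := by
  have h0 : Ioi (0 : ℝ) = Ioc 0 1 ∪ Ioi 1 := (Ioc_union_Ioi_eq_Ioi zero_le_one).symm
  unfold growthConst
  rw [h0]
  refine ne_top_of_le_ne_top ?_ (lintegral_union_le _ _ _)
  have hpos : 0 < 1 + 2 * m := by linarith
  refine ENNReal.add_ne_top.2 ⟨?_, ?_⟩
  · have hI : IntegrableOn (fun t : ℝ => 2 * t ^ (-(1 + 2 * m)⁻¹ * 2)) (Ioc 0 1) := by
      refine Integrable.const_mul ?_ 2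
      have := intervalIntegral.intervalIntegrable_rpow' (a := 0) (b := 1) (r := -(1 + 2 * m)⁻¹ * 2) (by
        have : (1 + 2 * m)⁻¹ * 2 < 1 := by rw [inv_mul_lt_iff₀ hpos]; linarith
        linarith)
      exact (intervalIntegrable_iff_integrableOn_Ioc_of_le zero_le_one).1 this
    refine ne_top_of_le_ne_top hI.lintegral_lt_top.ne ?_
    refine setLIntegral_mono' measurableSet_Ioc fun t ht => ENNReal.ofReal_le_ofReal ?_
    refine (min_le_right _ _).trans_eq ?_
    rw [← Real.rpow_mul_natCast ht.1.le]; norm_num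
  · have hI : IntegrableOn (fun t : ℝ => t ^ (-2 : ℝ)) (Ioi 1) :=
      integrableOn_Ioi_rpow_of_lt (by norm_num) one_pos
    refine ne_top_of_le_ne_top hI.lintegral_lt_top.ne ?_
    refine setLIntegral_mono' measurableSet_Ioi fun t ht => ENNReal.ofReal_le_ofReal ?_
    refine (min_le_left _ _).trans_eq ?_
    have : (0 : ℝ) ≤ t := zero_le_one.trans (le_of_lt ht)
    rw [Real.rpow_neg this, inv_pow]; norm_num

/-- The singular weight `|x|⁻¹ ⟨k + x⟩^{-2m}`, `m > 1/2`, is integrable, uniformly in `k`, against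
every measure for which balls of radius `R` have mass `O(R²)`, by the layer-cake formula. -/
theorem lintegral_le_of_growth {X : Type*} [MeasurableSpace X] {μ : Measure X} {φ : X → R3}
    (hφ : Measurable φ) {m : ℝ} (hm : 1 / 2 < m) {A : ℝ≥0∞}
    (h : ∀ (y : R3) (R : ℝ), 0 < R → μ {x | ‖φ x - y‖ ≤ R} ≤ A * ENNReal.ofReal (R ^ 2)) (k : R3) :
    ∫⁻ x, ENNReal.ofReal (‖φ x‖⁻¹ * bracket (k + φ x) ^ (-(2 * m))) ∂μ ≤ A * growthConst m := by
  have hb : Measurable fun x : R3 => bracket (k + x) ^ (-(2 * m)) :=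
    ((continuous_bracket_rpow _).comp (continuous_const.add continuous_id)).measurable
  rw [lintegral_eq_lintegral_meas_lt μ]
  rotate_left
  · exact Filter.Eventually.of_forall fun x =>
      mul_nonneg (by positivity) (Real.rpow_nonneg (bracket_pos _).le _)
  · exact (hφ.norm.inv.mul (hb.comp hφ)).aemeasurable
  unfold growthConst
  rw [← lintegral_const_mul _ (by fun_prop)]
  refine setLIntegral_mono' measurableSet_Ioi fun t ht => ?_
  have ht : 0 < t := ht
  have hpos : 0 < 1 + 2 * m := by linarith
  rw [ENNReal.ofReal_min, mul_min]
  refine le_min ?_ ?_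
  · refine le_trans (measure_mono ?_) (h 0 t⁻¹ (by positivity))
    intro x hx
    have hx : t < ‖φ x‖⁻¹ * bracket (k + φ x) ^ (-(2 * m)) := hx
    have h1 : bracket (k + φ x) ^ (-(2 * m)) ≤ 1 :=
      Real.rpow_le_one_of_one_le_of_nonpos (one_le_bracket _) (by linarith)
    have h2 : t < ‖φ x‖⁻¹ := hx.trans_le (mul_le_of_le_one_right (by positivity) h1)
    simp only [mem_ofPred_eq, sub_zero]
    exact (le_inv_comm₀ ht (inv_pos.1 (ht.trans h2))).1 h2.le
  -- The radius `ρ` solves `ρ⁻¹ ρ^{-2m} = t`; away from the two balls of radius `ρ` around the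
  -- singularity and around `-k`, both factors of the weight are below their value at `ρ`.
  · set ρ := t ^ (-(1 + 2 * m)⁻¹) with hρ
    have hρpos : 0 < ρ := Real.rpow_pos_of_pos ht _
    have hsub : {x | t < ‖φ x‖⁻¹ * bracket (k + φ x) ^ (-(2 * m))} ⊆
        {x | ‖φ x - 0‖ ≤ ρ} ∪ {x | ‖φ x - (-k)‖ ≤ ρ} := by
      intro x hx
      by_contra hcon
      simp only [mem_union, mem_ofPred_eq, sub_zero, sub_neg_eq_add, not_or, not_le] at hcon
      obtain ⟨h1, h2⟩ := hcon
      have hx : t < ‖φ x‖⁻¹ * bracket (k + φ x) ^ (-(2 * m)) := hx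
      have h3 : ρ ≤ bracket (k + φ x) := by
        have := norm_le_bracket (k + φ x)
        rw [add_comm] at h2; linarith
      have h4 : bracket (k + φ x) ^ (-(2 * m)) ≤ ρ ^ (-(2 * m)) :=
        Real.rpow_le_rpow_of_nonpos hρpos h3 (by linarith)
      have h5 : ‖φ x‖⁻¹ ≤ ρ⁻¹ := inv_anti₀ hρpos h1.le
      have h6 : ρ⁻¹ * ρ ^ (-(2 * m)) = t := by
        rw [← Real.rpow_neg_one ρ, ← Real.rpow_add hρpos, hρ, ← Real.rpow_mul ht.le]
        rw [show -(1 + 2 * m)⁻¹ * (-1 + -(2 * m)) = 1 by field_simp; ring, Real.rpow_one]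
      have : ‖φ x‖⁻¹ * bracket (k + φ x) ^ (-(2 * m)) ≤ ρ⁻¹ * ρ ^ (-(2 * m)) := by
        gcongr
        exact Real.rpow_nonneg (bracket_pos _).le _
      linarith
    refine (measure_mono hsub).trans ((measure_union_le _ _).trans ?_)
    refine (add_le_add (h 0 ρ hρpos) (h (-k) ρ hρpos)).trans_eq ?_
    rw [ENNReal.ofReal_mul (by norm_num)]
    norm_num
    ring

/-! ### The map from incoming to outgoing displacements -/

/-- The displacement `a = k^* - k = (z - |z| s) / 2`, where `z = k₁ - k`. -/
def aMap (s z : R3) : R3 := (1 / 2 : ℝ) • (z - ‖z‖ • s)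

/-- The inverse of `aMap s`, which recovers the displacement `z = k₁ - k` from `a`: the map
`aMap s` sends the complement of the ray spanned by `s` to the half-space `s ⬝ a < 0`, where
the denominator is positive. -/
def zMap (s a : R3) : R3 := (2 : ℝ) • a + (‖a‖ ^ 2 / (-inner ℝ s a)) • s

theorem measurable_aMap_prod : Measurable fun q : S2 × R3 => aMap (q.1 : R3) q.2 := by
  unfold aMap; fun_prop

theorem sub_aMap (s z : R3) : z - aMap s z = aMap (-s) z := by
  unfold aMap; module

theorem inner_aMap {s : R3} (hs : ‖s‖ = 1) (z : R3) :
    inner ℝ s (aMap s z) = ((inner ℝ s z : ℝ) - ‖z‖) / 2 := by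
  rw [aMap, inner_smul_right, inner_sub_right, inner_smul_right, real_inner_self_eq_norm_sq, hs]
  ring

theorem norm_aMap_sq {s : R3} (hs : ‖s‖ = 1) (z : R3) :
    ‖aMap s z‖ ^ 2 = ‖z‖ * (‖z‖ - inner ℝ s z) / 2 := by
  rw [aMap, norm_smul, mul_pow, norm_sub_sq_real, norm_smul, inner_smul_right, hs,
    real_inner_comm z s]
  norm_num
  ring

theorem norm_zMap {s a : R3} (hs : ‖s‖ = 1) (ha : inner ℝ s a < (0 : ℝ)) :
    ‖zMap s a‖ = ‖a‖ ^ 2 / (-inner ℝ s a) := by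
  have h0 : (0 : ℝ) < -inner ℝ s a := by linarith
  rw [← sq_eq_sq₀ (norm_nonneg _) (by positivity), zMap, norm_add_sq_real, norm_smul, norm_smul,
    inner_smul_left, inner_smul_right, hs, real_inner_comm s a]
  simp only [Real.norm_eq_abs, mul_one, mul_pow, sq_abs, conj_trivial]
  have : (inner ℝ s a : ℝ) ≠ 0 := by linarith
  field_simp
  ring

theorem zMap_aMap {s z : R3} (hs : ‖s‖ = 1) (hz : inner ℝ s z < ‖z‖) :
    zMap s (aMap s z) = z := by
  have h : ‖aMap s z‖ ^ 2 / (-inner ℝ s (aMap s z)) = ‖z‖ := by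
    rw [norm_aMap_sq hs, inner_aMap hs]
    have : ‖z‖ - inner ℝ s z ≠ 0 := by linarith
    have h2 : -(((inner ℝ s z : ℝ) - ‖z‖) / 2) = (‖z‖ - inner ℝ s z) / 2 := by ring
    rw [h2]
    field_simp
  rw [zMap, h, aMap]
  module

theorem hasFDerivAt_aMap (s : R3) {z : R3} (hz : z ≠ 0) :
    HasFDerivAt (aMap s) ((1 / 2 : ℝ) • (ContinuousLinearMap.id ℝ R3 -
      (‖z‖⁻¹ • innerSL ℝ z).smulRight s)) z := by
  have hn : HasFDerivAt (fun x : R3 => ‖x‖) (‖z‖⁻¹ • innerSL ℝ z) z := by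
    have h1 := (hasStrictFDerivAt_norm_sq z).hasFDerivAt.sqrt (by simpa using hz)
    have h2 : (fun x : R3 => Real.sqrt (‖x‖ ^ 2)) = fun x => ‖x‖ := by
      funext x; exact Real.sqrt_sq (norm_nonneg _)
    rw [h2] at h1
    have h3 : (1 / (2 * Real.sqrt (‖z‖ ^ 2))) • 2 • innerSL ℝ z = ‖z‖⁻¹ • innerSL ℝ z := by
      rw [Real.sqrt_sq (norm_nonneg _), two_smul, smul_add, ← add_smul]
      congr 1
      field_simp
      norm_num
    rwa [h3] at h1
  exact ((hasFDerivAt_id z).sub (hn.smul_const s)).const_smul (1 / 2 : ℝ)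

theorem det_fderiv_aMap (s z : R3) :
    ((1 / 2 : ℝ) • (ContinuousLinearMap.id ℝ R3 - (‖z‖⁻¹ • innerSL ℝ z).smulRight s)).det =
      (1 - ‖z‖⁻¹ * inner ℝ s z) / 8 := by
  have h : (((1 / 2 : ℝ) • (ContinuousLinearMap.id ℝ R3 - (‖z‖⁻¹ • innerSL ℝ z).smulRight s) :
      R3 →L[ℝ] R3) : R3 →ₗ[ℝ] R3) =
      (1 / 2 : ℝ) • LinearMap.transvection (‖z‖⁻¹ • innerSL ℝ z).toLinearMap (-s) := by
    ext1 x
    change (1 / 2 : ℝ) • (x - (‖z‖⁻¹ • inner ℝ z x : ℝ) • s) =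
      (1 / 2 : ℝ) • (x + (‖z‖⁻¹ • inner ℝ z x : ℝ) • (-s))
    module
  rw [ContinuousLinearMap.det, h, LinearMap.det_smul, LinearMap.transvection.det]
  have h2 : (‖z‖⁻¹ • innerSL ℝ z).toLinearMap (-s) = -(‖z‖⁻¹ * inner ℝ s z) := by
    change (‖z‖⁻¹ • inner ℝ z (-s) : ℝ) = _
    rw [inner_neg_right, real_inner_comm, smul_eq_mul]; ring
  rw [h2]
  norm_num
  ring

/-- The change of variables `z ↦ a` for a fixed direction `s`, with Jacobian
`da = (s ⬝ a)² / (4 |a|²) dz`. The ray spanned by `s` is mapped to `a = 0`. -/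
theorem lintegral_aMap_le {s : R3} (hs : ‖s‖ = 1) (H : R3 → R3 → ℝ≥0∞) (hH : ∀ z, H z 0 = 0) :
    ∫⁻ z, H z (aMap s z) ≤
      ∫⁻ a in {a : R3 | inner ℝ s a < (0 : ℝ)},
        ENNReal.ofReal (4 * ‖a‖ ^ 2 / inner ℝ s a ^ 2) * H (zMap s a) a := by
  set U : Set R3 := {z : R3 | inner ℝ s z < ‖z‖} with hU
  have hUm : MeasurableSet U := (isOpen_lt (by fun_prop) (by fun_prop)).measurableSet
  have hne : ∀ z ∈ U, z ≠ 0 := by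
    rintro z hz rfl
    simp [hU] at hz
  have hsub : Function.support (fun z => H z (aMap s z)) ⊆ U := by
    intro z hz
    by_contra hcon
    have hcon : ‖z‖ ≤ inner ℝ s z := not_lt.1 hcon
    apply hz
    have : ‖aMap s z‖ ^ 2 = 0 := by
      refine le_antisymm ?_ (sq_nonneg _)
      rw [norm_aMap_sq hs]
      nlinarith [norm_nonneg z]
    have h0 : aMap s z = 0 := by simpa using this
    simp only [h0, hH]
  rw [← setLIntegral_eq_of_support_subset hsub]
  have hinj : InjOn (aMap s) U := by
    intro z hz z' hz' h
    rw [← zMap_aMap hs hz, ← zMap_aMap hs hz', h]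
  have hcv := lintegral_image_eq_lintegral_abs_det_fderiv_mul (volume : Measure R3) hUm
    (fun z hz => (hasFDerivAt_aMap s (hne z hz)).hasFDerivWithinAt) hinj
    (fun a => ENNReal.ofReal (4 * ‖a‖ ^ 2 / inner ℝ s a ^ 2) * H (zMap s a) a)
  have himg : aMap s '' U ⊆ {a : R3 | inner ℝ s a < (0 : ℝ)} := by
    rintro _ ⟨z, hz, rfl⟩
    have hz : inner ℝ s z < ‖z‖ := hz
    change inner ℝ s (aMap s z) < (0 : ℝ)
    rw [inner_aMap hs]
    linarith
  refine le_trans (le_of_eq ?_) (lintegral_mono_set himg)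
  rw [hcv]
  refine setLIntegral_congr_fun hUm fun z hz => ?_
  have hz' : inner ℝ s z < ‖z‖ := hz
  have hzp : 0 < ‖z‖ := norm_pos_iff.2 (hne z hz)
  have hd : 0 < ‖z‖ - inner ℝ s z := by linarith
  simp only [det_fderiv_aMap, zMap_aMap hs hz']
  rw [← mul_assoc, ← ENNReal.ofReal_mul (abs_nonneg _)]
  have h1 : |(1 - ‖z‖⁻¹ * inner ℝ s z) / 8| * (4 * ‖aMap s z‖ ^ 2 / inner ℝ s (aMap s z) ^ 2) = 1 := by
    have e1 : (1 - ‖z‖⁻¹ * inner ℝ s z) / 8 = (‖z‖ - inner ℝ s z) / (8 * ‖z‖) := by field_simp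
    rw [e1, abs_of_nonneg (by positivity), norm_aMap_sq hs, inner_aMap hs]
    have e2 : ((inner ℝ s z : ℝ) - ‖z‖) / 2 = -((‖z‖ - inner ℝ s z) / 2) := by ring
    rw [e2]
    field_simp
    norm_num
  rw [h1, ENNReal.ofReal_one, one_mul]

/-- For fixed `a`, the singular weight centred at `τ a` has a bounded integral over all directions
`σ`: the points `zMap σ a` fill the plane through `a` orthogonal to `a`, and the density
`4 |a|² c⁻³`, `c = -(a ⬝ σ) / |a|`, is that of a gnomonic projection of radius `|a|`. -/
theorem lintegral_sphere_zMap_le {m : ℝ} (hm : 1 / 2 < m) (τ : ℝ) (k : R3) {a : R3} (ha : a ≠ 0) :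
    ∫⁻ σ : S2 in {σ : S2 | inner ℝ (σ : R3) a < (0 : ℝ)},
      ENNReal.ofReal (4 * ‖a‖ ^ 2 / inner ℝ (σ : R3) a ^ 2) *
        ENNReal.ofReal (‖a‖ * ‖zMap σ a‖ * (‖zMap σ a - τ • a‖⁻¹ *
          bracket (k + (zMap σ a - τ • a)) ^ (-(2 * m)))) ∂surf ≤ 256 * growthConst m := by
  have hap : 0 < ‖a‖ := norm_pos_iff.2 ha
  set θ : R3 := (-‖a‖⁻¹) • a with hθd
  have hθ : ‖θ‖ = 1 := by
    rw [hθd, norm_smul, norm_neg, norm_inv, norm_norm, inv_mul_cancel₀ hap.ne']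
  have hc : ∀ σ : S2, inner ℝ (σ : R3) a = -(‖a‖ * inner ℝ θ (σ : R3) : ℝ) := by
    intro σ
    rw [hθd, inner_smul_left, real_inner_comm]
    simp only [conj_trivial]
    field_simp
  have hcm : Measurable fun σ : S2 => (inner ℝ θ (σ : R3) : ℝ) := by fun_prop
  have hset : {σ : S2 | inner ℝ (σ : R3) a < (0 : ℝ)} = {σ : S2 | 0 < (inner ℝ θ (σ : R3) : ℝ)} := by
    ext σ
    simp only [mem_ofPred_eq, hc, neg_lt_zero]
    exact mul_pos_iff_of_pos_left hap
  set D : Set S2 := {σ : S2 | 0 < (inner ℝ θ (σ : R3) : ℝ)} with hD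
  have hDm : MeasurableSet D := measurableSet_lt measurable_const hcm
  set φ : S2 → R3 := fun σ => (2 - τ) • a + (‖a‖ * (inner ℝ θ (σ : R3) : ℝ)⁻¹) • (σ : R3) with hφd
  have hφ : Measurable φ := by
    rw [hφd]
    exact ((hcm.inv.const_mul _).smul measurable_subtype_coe).const_add _
  set w : S2 → ℝ≥0∞ := fun σ => ENNReal.ofReal (4 * ‖a‖ ^ 2) *
    ENNReal.ofReal ((inner ℝ θ (σ : R3) : ℝ)⁻¹ ^ 3) with hwd
  have hw : Measurable w := ((hcm.inv.pow_const 3).ennreal_ofReal).const_mul _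
  have hb : Measurable fun x : R3 => bracket (k + x) ^ (-(2 * m)) :=
    ((continuous_bracket_rpow _).comp (continuous_const.add continuous_id)).measurable
  have hg : Measurable fun σ : S2 => ENNReal.ofReal (‖φ σ‖⁻¹ * bracket (k + φ σ) ^ (-(2 * m))) :=
    (hφ.norm.inv.mul (hb.comp hφ)).ennreal_ofReal
  have hgrow := lintegral_le_of_growth (μ := (surf.restrict D).withDensity w) hφ hm (A := 256) ?_ k
  · rw [lintegral_withDensity_eq_lintegral_mul _ hw hg] at hgrow
    rw [hset]
    refine le_trans (le_of_eq ?_) hgrow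
    refine setLIntegral_congr_fun hDm fun σ hσ => ?_
    have hσ : 0 < (inner ℝ θ (σ : R3) : ℝ) := hσ
    have hσn : ‖(σ : R3)‖ = 1 := norm_eq_of_mem_sphere σ
    have hneg : inner ℝ (σ : R3) a < (0 : ℝ) := by rw [hc]; nlinarith [mul_pos hap hσ]
    have hz : zMap σ a - τ • a = φ σ := by
      rw [zMap, hφd, hc]
      have : ‖a‖ ^ 2 / - -(‖a‖ * inner ℝ θ (σ : R3) : ℝ) = ‖a‖ * (inner ℝ θ (σ : R3) : ℝ)⁻¹ := by
        field_simp
      rw [this]; module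
    simp only [Pi.mul_apply, hwd]
    rw [hz, norm_zMap hσn hneg, hc, ← ENNReal.ofReal_mul (by positivity),
      ← ENNReal.ofReal_mul (by positivity), ← ENNReal.ofReal_mul (by positivity)]
    congr 1
    field_simp
  · intro y R hR
    have hS : MeasurableSet {σ | ‖φ σ - y‖ ≤ R} :=
      measurableSet_le (hφ.sub_const y).norm measurable_const
    have hgn := gnomonic_growth θ (‖a‖⁻¹ • (y - (2 - τ) • a)) hθ (R / ‖a‖)
    rw [withDensity_apply _ hS, Measure.restrict_restrict hS]
    have hw' : Measurable fun σ : S2 => ENNReal.ofReal ((inner ℝ θ (σ : R3) : ℝ)⁻¹ ^ 3) :=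
      (hcm.inv.pow_const 3).ennreal_ofReal
    rw [hwd, lintegral_const_mul _ hw']
    calc _ ≤ ENNReal.ofReal (4 * ‖a‖ ^ 2) * (64 * ENNReal.ofReal ((R / ‖a‖) ^ 2)) := by
          refine mul_le_mul_right (le_trans (lintegral_mono_set ?_) hgn) _
          rintro σ ⟨h1, h2⟩
          refine ⟨h2, ?_⟩
          have h1 : ‖φ σ - y‖ ≤ R := h1
          have : (inner ℝ θ (σ : R3) : ℝ)⁻¹ • (σ : R3) - ‖a‖⁻¹ • (y - (2 - τ) • a) =
              ‖a‖⁻¹ • (φ σ - y) := by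
            rw [hφd]
            simp only [smul_sub, smul_add, smul_smul, inv_mul_cancel_left₀ hap.ne']
            module
          rw [this, norm_smul, norm_inv, norm_norm, div_eq_inv_mul]
          gcongr
      _ = 256 * ENNReal.ofReal (R ^ 2) := by
          rw [show (64 : ℝ≥0∞) = ENNReal.ofReal 64 by norm_num,
            show (256 : ℝ≥0∞) = ENNReal.ofReal 256 by norm_num,
            ← ENNReal.ofReal_mul (by norm_num), ← ENNReal.ofReal_mul (by norm_num),
            ← ENNReal.ofReal_mul (by positivity)]
          congr 1
          field_simp
          norm_num

theorem measurable_bracket_rpow (l : ℝ) : Measurable fun k : R3 => bracket k ^ l :=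
  (continuous_bracket_rpow l).measurable

/-- The integral over all collisions of a function `G` of the outgoing displacement `a`, against
the weight that is singular at `z = τ a`, is controlled by the integral of `G`. The case `τ = 0`
concerns the displacement `k₁ - k`, the case `τ = 1` the displacement `k₁^* - k = z - a`. -/
theorem lintegral_collisions_le {m : ℝ} (hm : 1 / 2 < m) (τ : ℝ) (k : R3) {G : R3 → ℝ≥0∞}
    (hG : Measurable G) :
    ∫⁻ σ : S2, (∫⁻ z : R3, ENNReal.ofReal (‖aMap σ z‖ * ‖z‖ * (‖z - τ • aMap σ z‖⁻¹ *
      bracket (k + (z - τ • aMap σ z)) ^ (-(2 * m)))) * G (aMap σ z)) ∂surf ≤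
      256 * growthConst m * ∫⁻ a, G a := by
  set W : R3 → R3 → ℝ≥0∞ := fun z a =>
    ENNReal.ofReal (‖a‖ * ‖z‖ * (‖z - τ • a‖⁻¹ * bracket (k + (z - τ • a)) ^ (-(2 * m)))) with hW
  set V : S2 → R3 → ℝ≥0∞ := fun σ a => {q : S2 × R3 | inner ℝ (q.1 : R3) q.2 < (0 : ℝ)}.indicator
    (fun q => ENNReal.ofReal (4 * ‖q.2‖ ^ 2 / inner ℝ (q.1 : R3) q.2 ^ 2) *
      W (zMap q.1 q.2) q.2) (σ, a) with hV
  have hVm : Measurable (Function.uncurry V) := by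
    have hi : Measurable fun q : S2 × R3 => (inner ℝ (q.1 : R3) q.2 : ℝ) := by fun_prop
    have hz : Measurable fun q : S2 × R3 => zMap q.1 q.2 := by
      unfold zMap
      exact (measurable_snd.const_smul (2 : ℝ)).add
        (((measurable_snd.norm.pow_const 2).div hi.neg).smul (measurable_subtype_coe.comp measurable_fst))
    have hx : Measurable fun q : S2 × R3 => zMap q.1 q.2 - τ • q.2 :=
      hz.sub (measurable_snd.const_smul τ)
    refine Measurable.indicator ?_ (measurableSet_lt hi measurable_const)
    refine Measurable.mul (Measurable.ennreal_ofReal ?_) (Measurable.ennreal_ofReal ?_)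
    · exact ((measurable_snd.norm.pow_const 2).const_mul 4).div (hi.pow_const 2)
    · exact (measurable_snd.norm.mul hz.norm).mul
        (hx.norm.inv.mul ((measurable_bracket_rpow _).comp (hx.const_add k)))
  have hVa : ∀ σ : S2, ∀ a : R3, V σ a = {a : R3 | inner ℝ (σ : R3) a < (0 : ℝ)}.indicator
      (fun a => ENNReal.ofReal (4 * ‖a‖ ^ 2 / inner ℝ (σ : R3) a ^ 2) * W (zMap σ a) a) a := by
    intro σ a; rfl
  have hVs : ∀ σ : S2, ∀ a : R3, V σ a = {σ : S2 | inner ℝ (σ : R3) a < (0 : ℝ)}.indicator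
      (fun σ : S2 => ENNReal.ofReal (4 * ‖a‖ ^ 2 / inner ℝ (σ : R3) a ^ 2) * W (zMap σ a) a) σ := by
    intro σ a; rfl
  calc _ ≤ ∫⁻ σ : S2, (∫⁻ a : R3, V σ a * G a) ∂surf := by
        refine lintegral_mono fun σ => ?_
        have hσn : ‖(σ : R3)‖ = 1 := norm_eq_of_mem_sphere σ
        have hset : MeasurableSet {a : R3 | inner ℝ (σ : R3) a < (0 : ℝ)} :=
          (isOpen_lt (by fun_prop) (by fun_prop)).measurableSet
        refine (lintegral_aMap_le hσn (fun z a => W z a * G a) fun z => by simp [hW]).trans_eq ?_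
        rw [← lintegral_indicator hset]
        refine lintegral_congr fun a => ?_
        rw [hVa]
        by_cases h : a ∈ {a : R3 | inner ℝ (σ : R3) a < (0 : ℝ)}
        · rw [indicator_of_mem h, indicator_of_mem h, mul_assoc]
        · rw [indicator_of_notMem h, indicator_of_notMem h, zero_mul]
    _ = ∫⁻ a : R3, (∫⁻ σ : S2, V σ a * G a ∂surf) := by
        refine lintegral_lintegral_swap ?_
        exact (hVm.mul (hG.comp measurable_snd)).aemeasurable
    _ ≤ ∫⁻ a : R3, 256 * growthConst m * G a := by
        refine lintegral_mono fun a => ?_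
        have hset : MeasurableSet {σ : S2 | inner ℝ (σ : R3) a < (0 : ℝ)} :=
          (isOpen_lt (by fun_prop) (by fun_prop)).measurableSet
        have hVma : Measurable fun σ => V σ a := hVm.comp measurable_prodMk_right
        rw [lintegral_mul_const _ hVma]
        refine mul_le_mul_left ?_ _
        simp only [hVs]
        rw [lintegral_indicator hset]
        by_cases ha : a = 0
        · simp [hW, ha]
        · exact lintegral_sphere_zMap_le hm τ k ha
    _ = _ := lintegral_const_mul _ hG

/-- For fixed `k` and `k₁ = k + z`, the weight that is singular at `k^* = k` has a bounded integral
over the sphere of radius `|z|/2` on which `k^*` lies. -/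
theorem lintegral_sphere_aMap_le {m : ℝ} (hm : 1 / 2 < m) (k z : R3) :
    ∫⁻ σ : S2, ENNReal.ofReal (‖z‖ ^ 2 * (‖aMap σ z‖⁻¹ *
      bracket (k + aMap σ z) ^ (-(2 * m)))) ∂surf ≤ 1536 * growthConst m := by
  by_cases hz : z = 0
  · simp [hz]
  have hzp : 0 < ‖z‖ := norm_pos_iff.2 hz
  have hφ : Measurable fun σ : S2 => aMap σ z := measurable_aMap_prod.comp measurable_prodMk_right
  have hg : Measurable fun σ : S2 =>
      ENNReal.ofReal (‖aMap σ z‖⁻¹ * bracket (k + aMap σ z) ^ (-(2 * m))) :=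
    (hφ.norm.inv.mul ((measurable_bracket_rpow _).comp (hφ.const_add k))).ennreal_ofReal
  have hgrow := lintegral_le_of_growth (μ := ENNReal.ofReal (‖z‖ ^ 2) • surf) hφ hm (A := 1536) ?_ k
  · rw [lintegral_smul_measure, smul_eq_mul, ← lintegral_const_mul _ hg] at hgrow
    simpa only [← ENNReal.ofReal_mul (sq_nonneg ‖z‖)] using hgrow
  · intro y R hR
    have hcap := surf_cap_le (‖z‖⁻¹ • (z - (2 : ℝ) • y)) (2 * R / ‖z‖)
    rw [Measure.smul_apply, smul_eq_mul]
    calc _ ≤ ENNReal.ofReal (‖z‖ ^ 2) * (384 * ENNReal.ofReal ((2 * R / ‖z‖) ^ 2)) := by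
          refine mul_le_mul_right (le_trans (measure_mono ?_) hcap) _
          intro σ hσ
          have hσ : ‖aMap σ z - y‖ ≤ R := hσ
          have h1 : (σ : R3) - ‖z‖⁻¹ • (z - (2 : ℝ) • y) = (-(2 * ‖z‖⁻¹)) • (aMap σ z - y) := by
            have : (σ : R3) = (‖z‖⁻¹ * ‖z‖) • (σ : R3) := by
              rw [inv_mul_cancel₀ hzp.ne', one_smul]
            rw [aMap]
            nth_rewrite 1 [this]
            module
          change ‖(σ : R3) - ‖z‖⁻¹ • (z - (2 : ℝ) • y)‖ ≤ 2 * R / ‖z‖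
          rw [h1, norm_smul, norm_neg, Real.norm_of_nonneg (by positivity), div_eq_mul_inv]
          calc 2 * ‖z‖⁻¹ * ‖aMap σ z - y‖ ≤ 2 * ‖z‖⁻¹ * R := by gcongr
            _ = _ := by ring
      _ = 1536 * ENNReal.ofReal (R ^ 2) := by
          rw [show (384 : ℝ≥0∞) = ENNReal.ofReal 384 by norm_num,
            show (1536 : ℝ≥0∞) = ENNReal.ofReal 1536 by norm_num,
            ← ENNReal.ofReal_mul (by norm_num), ← ENNReal.ofReal_mul (by norm_num),
            ← ENNReal.ofReal_mul (by positivity)]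
          congr 1
          field_simp
          norm_num

/-- The Cauchy-Schwarz inequality for a function whose square is dominated by a product. -/
theorem lintegral_le_sqrt_mul_sqrt {X : Type*} [MeasurableSpace X] {μ : Measure X}
    {h P Q : X → ℝ≥0∞} (hP : AEMeasurable P μ) (hQ : AEMeasurable Q μ)
    (hle : ∀ᵐ x ∂μ, h x ^ 2 ≤ P x * Q x) :
    ∫⁻ x, h x ∂μ ≤ (∫⁻ x, P x ∂μ) ^ (1 / 2 : ℝ) * (∫⁻ x, Q x ∂μ) ^ (1 / 2 : ℝ) := by
  have h2 : ∀ x : ℝ≥0∞, (x ^ (1 / 2 : ℝ)) ^ (2 : ℝ) = x := by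
    intro x; rw [← ENNReal.rpow_mul]; norm_num
  have hpq : (2 : ℝ).HolderConjugate 2 := by
    rw [Real.holderConjugate_iff]; norm_num
  have := ENNReal.lintegral_mul_le_Lp_mul_Lq μ hpq (hP.pow_const (1 / 2 : ℝ))
    (hQ.pow_const (1 / 2 : ℝ))
  simp only [h2] at this
  refine le_trans (lintegral_mono_ae ?_) this
  filter_upwards [hle] with x hx
  have h3 : h x = (h x ^ 2) ^ (1 / 2 : ℝ) := by
    rw [← ENNReal.rpow_natCast, ← ENNReal.rpow_mul]; norm_num
  rw [h3, Pi.mul_apply, ← ENNReal.mul_rpow_of_nonneg _ _ (by norm_num)]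
  exact ENNReal.rpow_le_rpow hx (by norm_num)

/-! ### Uniform bounds on collision frequencies -/

instance : SFinite resonantMeasure :=
  Measure.prod.instSFinite

theorem kStar_add (k z : R3) (σ : S2) : kStar k (k + z) σ = k + aMap σ z := by
  have : k - (k + z) = -z := by abel
  rw [kStar, aMap, this, norm_neg]
  module

theorem kOneStar_add (k z : R3) (σ : S2) : kOneStar k (k + z) σ = k + (z - aMap σ z) := by
  have : k - (k + z) = -z := by abel
  rw [kOneStar, aMap, this, norm_neg]
  module

theorem kStar_neg (k k₁ : R3) (σ : S2) : kStar k k₁ (-σ) = kOneStar k k₁ σ := by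
  simp [kStar, kOneStar]

theorem kStar_comm (k k₁ : R3) (σ : S2) : kStar k k₁ σ = kStar k₁ k σ := by
  rw [kStar, kStar, add_comm k k₁, norm_sub_rev]

@[fun_prop]
theorem measurable_kStar {X : Type*} [MeasurableSpace X] {u v : X → R3} {s : X → S2}
    (hu : Measurable u) (hv : Measurable v) (hs : Measurable s) :
    Measurable fun x => kStar (u x) (v x) (s x) := by
  unfold kStar; fun_prop

@[fun_prop]
theorem measurable_kOneStar {X : Type*} [MeasurableSpace X] {u v : X → R3} {s : X → S2}
    (hu : Measurable u) (hv : Measurable v) (hs : Measurable s) :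
    Measurable fun x => kOneStar (u x) (v x) (s x) := by
  unfold kOneStar; fun_prop

theorem lintegral_resonant_neg (Φ : R3 × S2 → ℝ≥0∞) (hΦ : Measurable Φ) :
    ∫⁻ p, Φ (p.1, -p.2) ∂resonantMeasure = ∫⁻ p, Φ p ∂resonantMeasure :=
  ((MeasurePreserving.id volume).prod measurePreserving_neg_surf).lintegral_comp hΦ

theorem lintegral_resonant_translate (k : R3) (Φ : R3 × S2 → ℝ≥0∞) (hΦ : Measurable Φ) :
    ∫⁻ p, Φ p ∂resonantMeasure = ∫⁻ q, Φ (k + q.1, q.2) ∂resonantMeasure :=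
  (((measurePreserving_add_left (volume : Measure R3) k).prod
    (MeasurePreserving.id surf)).lintegral_comp hΦ).symm

/-- The square `‖⟨k⟩^m f‖²` of the weighted `L²` norm. -/
def weightedSq (m : ℝ) (f : R3 → ℝ≥0∞) : ℝ≥0∞ :=
  ∫⁻ x, (ENNReal.ofReal (bracket x ^ m) * f x) ^ 2

theorem bracket_rpow_cancel (m : ℝ) (k : R3) :
    bracket k ^ (-(2 * m)) * (bracket k ^ m) ^ 2 = 1 := by
  rw [← Real.rpow_mul_natCast (bracket_pos k).le, ← Real.rpow_add (bracket_pos k)]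
  norm_num
  rw [show -(2 * m) + m * 2 = 0 by ring, Real.rpow_zero]

/-- Almost every collision is nondegenerate. The weights `|a|⁻¹` take the value `0` at `a = 0`, so
that degenerate collisions have to be excluded when the Cauchy-Schwarz weights are cancelled. -/
theorem ae_aMap_ne_zero : ∀ᵐ q : R3 × S2 ∂resonantMeasure, q.1 ≠ 0 → aMap q.2 q.1 ≠ 0 := by
  have hm : Measurable fun q : R3 × S2 => aMap q.2 q.1 := measurable_aMap_prod.comp measurable_swap
  have hset : MeasurableSet {q : R3 × S2 | q.1 ≠ 0 → aMap q.2 q.1 ≠ 0} := by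
    have h1 : MeasurableSet {q : R3 × S2 | q.1 = 0} := measurable_fst (measurableSet_singleton 0)
    have h2 : MeasurableSet {q : R3 × S2 | aMap q.2 q.1 = 0} := hm (measurableSet_singleton 0)
    exact h1.compl.imp h2.compl
  refine (Measure.ae_prod_iff_ae_ae hset).2 (Filter.Eventually.of_forall fun z => ?_)
  rw [ae_iff]
  refine le_antisymm ?_ zero_le
  have hcap := surf_cap_le (‖z‖⁻¹ • z) 0
  simp only [ne_eq, OfNat.ofNat_ne_zero, not_false_eq_true, zero_pow, ENNReal.ofReal_zero,
    mul_zero] at hcap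
  refine le_trans (measure_mono ?_) hcap
  intro σ hσ
  simp only [mem_ofPred_eq, Classical.not_imp, not_not, aMap, smul_eq_zero, sub_eq_zero] at hσ
  obtain ⟨hz, h | h⟩ := hσ
  · norm_num at h
  · have h3 : ‖z‖⁻¹ • z = (σ : R3) := by
      nth_rewrite 2 [h]
      rw [smul_smul, inv_mul_cancel₀ (norm_ne_zero_iff.2 hz), one_smul]
    simp [h3]

/-- The weights in the Cauchy-Schwarz inequality: `X u²` and `Y v²` have to multiply to the square
of the kernel `w`. -/
theorem sq_ofReal_mul_le {X Y u v : ℝ} (hX : 0 ≤ X) (hu : 0 ≤ u) {w : ℝ}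
    (hw : 0 ≤ w) (hv : 0 ≤ v) (h : X * Y * u ^ 2 * v ^ 2 = w ^ 2) (f g : ℝ≥0∞) :
    (ENNReal.ofReal w * (f * g)) ^ 2 ≤
      (ENNReal.ofReal X * (ENNReal.ofReal u * f) ^ 2) *
        (ENNReal.ofReal Y * (ENNReal.ofReal v * g) ^ 2) := by
  have : ENNReal.ofReal w ^ 2 = ENNReal.ofReal X * ENNReal.ofReal Y * ENNReal.ofReal u ^ 2 *
      ENNReal.ofReal v ^ 2 := by
    rw [← ENNReal.ofReal_pow hw, ← h, ENNReal.ofReal_mul' (by positivity),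
      ENNReal.ofReal_mul' (by positivity), ENNReal.ofReal_mul hX, ENNReal.ofReal_pow hu,
      ENNReal.ofReal_pow hv]
  rw [mul_pow, this]
  apply le_of_eq
  ring

/-- The constant of the uniform bounds on the collision frequencies, the larger one of those in
`lintegral_collisions_le` and `lintegral_sphere_aMap_le`. -/
def frequencyConst (m : ℝ) : ℝ≥0∞ := 1536 * growthConst m

theorem frequencyConst_ne_top {m : ℝ} (hm : 1 / 2 < m) : frequencyConst m ≠ ∞ :=
  ENNReal.mul_ne_top (by norm_num) (growthConst_ne_top hm)

theorem sqrt_mul_sqrt_le {C x y P Q : ℝ≥0∞} (hP : P ≤ C * x) (hQ : Q ≤ C * y) :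
    P ^ (1 / 2 : ℝ) * Q ^ (1 / 2 : ℝ) ≤ C * (x ^ (1 / 2 : ℝ) * y ^ (1 / 2 : ℝ)) := by
  have hC : C ^ (1 / 2 : ℝ) * C ^ (1 / 2 : ℝ) = C := by
    rw [← ENNReal.rpow_add_of_nonneg _ _ (by norm_num) (by norm_num)]; norm_num
  calc P ^ (1 / 2 : ℝ) * Q ^ (1 / 2 : ℝ)
      ≤ (C * x) ^ (1 / 2 : ℝ) * (C * y) ^ (1 / 2 : ℝ) := by gcongr
    _ = (C ^ (1 / 2 : ℝ) * C ^ (1 / 2 : ℝ)) * (x ^ (1 / 2 : ℝ) * y ^ (1 / 2 : ℝ)) := by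
        rw [ENNReal.mul_rpow_of_nonneg _ _ (by norm_num), ENNReal.mul_rpow_of_nonneg _ _ (by norm_num)]
        ring
    _ = _ := by rw [hC]

theorem measurable_displacement : Measurable fun q : R3 × S2 => aMap q.2 q.1 :=
  measurable_aMap_prod.comp measurable_swap

theorem measurable_singular (m τ : ℝ) (k : R3) : Measurable fun q : R3 × S2 =>
    ENNReal.ofReal (‖aMap q.2 q.1‖ * ‖q.1‖ * (‖q.1 - τ • aMap q.2 q.1‖⁻¹ *
      bracket (k + (q.1 - τ • aMap q.2 q.1)) ^ (-(2 * m)))) := by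
  have ha := measurable_displacement
  have hx : Measurable fun q : R3 × S2 => q.1 - τ • aMap q.2 q.1 :=
    measurable_fst.sub (ha.const_smul τ)
  exact ((ha.norm.mul measurable_fst.norm).mul
    (hx.norm.inv.mul ((measurable_bracket_rpow _).comp (hx.const_add k)))).ennreal_ofReal

theorem measurable_weighted {m : ℝ} {g : R3 → ℝ≥0∞} (hg : Measurable g) :
    Measurable fun x => (ENNReal.ofReal (bracket x ^ m) * g x) ^ 2 :=
  ((measurable_bracket_rpow m).ennreal_ofReal.mul hg).pow_const 2

/-- The estimate `lintegral_collisions_le` for the weighted square of a function of `k^*`. -/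
theorem lintegral_singular_le {m : ℝ} (hm : 1 / 2 < m) {g : R3 → ℝ≥0∞} (hg : Measurable g) (k : R3)
    (τ : ℝ) :
    ∫⁻ q : R3 × S2, ENNReal.ofReal (‖aMap q.2 q.1‖ * ‖q.1‖ * (‖q.1 - τ • aMap q.2 q.1‖⁻¹ *
      bracket (k + (q.1 - τ • aMap q.2 q.1)) ^ (-(2 * m)))) *
        (ENNReal.ofReal (bracket (k + aMap q.2 q.1) ^ m) * g (k + aMap q.2 q.1)) ^ 2
          ∂resonantMeasure ≤ frequencyConst m * weightedSq m g := by
  have hG : Measurable fun x => (ENNReal.ofReal (bracket (k + x) ^ m) * g (k + x)) ^ 2 :=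
    (measurable_weighted hg).comp (measurable_const_add k)
  have hmeas := (measurable_singular m τ k).mul (hG.comp measurable_displacement)
  have h1 := lintegral_collisions_le hm τ k hG
  have h2 := lintegral_add_left_eq_self (μ := (volume : Measure R3))
    (fun x => (ENNReal.ofReal (bracket x ^ m) * g x) ^ 2) k
  rw [h2] at h1
  have h3 := lintegral_prod_symm (μ := (volume : Measure R3)) (ν := surf) _ hmeas.aemeasurable
  refine (h3.trans_le h1).trans ?_
  unfold frequencyConst weightedSq
  gcongr
  norm_num

/-- The collision frequency is bounded uniformly in `k`. The Cauchy-Schwarz weights are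
`|z|² |a|⁻¹ ⟨k^*⟩^{-2m} ⟨k₁⟩^{2m}` for `f`, to be integrated over the sphere of all `k^*`, and
`|a| |z| |z|⁻¹ ⟨k₁⟩^{-2m} ⟨k^*⟩^{2m}` for `g`, to be integrated over the plane of all `k₁`. -/
theorem lintegral_frequency_le {m : ℝ} (hm : 1 / 2 < m) {f g : R3 → ℝ≥0∞} (hf : Measurable f)
    (hg : Measurable g) (k : R3) :
    ∫⁻ p, ENNReal.ofReal ‖k - p.1‖ * (f p.1 * g (kStar k p.1 p.2)) ∂resonantMeasure ≤
      frequencyConst m * (weightedSq m f ^ (1 / 2 : ℝ) * weightedSq m g ^ (1 / 2 : ℝ)) := by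
  rw [lintegral_resonant_translate k _ (by fun_prop)]
  have hn : ∀ z : R3, ‖k - (k + z)‖ = ‖z‖ := fun z => by rw [sub_add_cancel_left, norm_neg]
  simp only [kStar_add, hn]
  have ha := measurable_displacement
  set P : R3 × S2 → ℝ≥0∞ := fun q => ENNReal.ofReal (‖q.1‖ ^ 2 * (‖aMap q.2 q.1‖⁻¹ *
    bracket (k + aMap q.2 q.1) ^ (-(2 * m)))) *
      (ENNReal.ofReal (bracket (k + q.1) ^ m) * f (k + q.1)) ^ 2 with hP
  set Q : R3 × S2 → ℝ≥0∞ := fun q => ENNReal.ofReal (‖aMap q.2 q.1‖ * ‖q.1‖ *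
      (‖q.1 - (0 : ℝ) • aMap q.2 q.1‖⁻¹ *
      bracket (k + (q.1 - (0 : ℝ) • aMap q.2 q.1)) ^ (-(2 * m)))) *
        (ENNReal.ofReal (bracket (k + aMap q.2 q.1) ^ m) * g (k + aMap q.2 q.1)) ^ 2 with hQ
  have hF : Measurable fun x => (ENNReal.ofReal (bracket (k + x) ^ m) * f (k + x)) ^ 2 :=
    (measurable_weighted hf).comp (measurable_const_add k)
  have hPw : Measurable fun q : R3 × S2 => ENNReal.ofReal (‖q.1‖ ^ 2 * (‖aMap q.2 q.1‖⁻¹ *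
      bracket (k + aMap q.2 q.1) ^ (-(2 * m)))) :=
    ((measurable_fst.norm.pow_const 2).mul (ha.norm.inv.mul
      ((measurable_bracket_rpow _).comp (ha.const_add k)))).ennreal_ofReal
  have hPm : Measurable P := hPw.mul (hF.comp measurable_fst)
  have hQm : Measurable Q := (measurable_singular m 0 k).mul
    (((measurable_weighted hg).comp (measurable_const_add k)).comp ha)
  have hPi : ∫⁻ q, P q ∂resonantMeasure ≤ frequencyConst m * weightedSq m f := by
    rw [resonantMeasure, lintegral_prod _ hPm.aemeasurable]
    calc _ ≤ ∫⁻ z : R3, frequencyConst m *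
          (ENNReal.ofReal (bracket (k + z) ^ m) * f (k + z)) ^ 2 := by
          refine lintegral_mono fun z => ?_
          simp only [hP]
          have haz : Measurable fun σ : S2 => aMap σ z :=
            measurable_aMap_prod.comp measurable_prodMk_right
          have hPz : Measurable fun σ : S2 => ENNReal.ofReal (‖z‖ ^ 2 * (‖aMap σ z‖⁻¹ *
              bracket (k + aMap σ z) ^ (-(2 * m)))) :=
            ((haz.norm.inv.mul ((measurable_bracket_rpow _).comp (haz.const_add k))).const_mul
              _).ennreal_ofReal
          rw [lintegral_mul_const _ hPz]
          have hs := lintegral_sphere_aMap_le hm k z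
          rw [← frequencyConst] at hs
          exact mul_le_mul_left hs _
      _ = frequencyConst m * weightedSq m f := by
          rw [lintegral_const_mul _ hF, weightedSq]
          congr 1
          exact lintegral_add_left_eq_self (fun x => (ENNReal.ofReal (bracket x ^ m) * f x) ^ 2) k
  refine (lintegral_le_sqrt_mul_sqrt hPm.aemeasurable hQm.aemeasurable ?_).trans
    (sqrt_mul_sqrt_le hPi (lintegral_singular_le hm hg k 0))
  filter_upwards [ae_aMap_ne_zero] with q hq
  by_cases hz : q.1 = 0
  · simp [hz]
  have hzp : 0 < ‖q.1‖ := norm_pos_iff.2 hz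
  have hap : 0 < ‖aMap q.2 q.1‖ := norm_pos_iff.2 (hq hz)
  have hb1 : 0 < bracket (k + q.1) := bracket_pos _
  have hb2 : 0 < bracket (k + aMap q.2 q.1) := bracket_pos _
  refine sq_ofReal_mul_le (by positivity) (by positivity) (by positivity) (by positivity) ?_ _ _
  simp only [zero_smul, sub_zero]
  have e1 := bracket_rpow_cancel m (k + q.1)
  have e2 := bracket_rpow_cancel m (k + aMap q.2 q.1)
  calc _ = ‖q.1‖ ^ 2 * (‖aMap q.2 q.1‖⁻¹ * ‖aMap q.2 q.1‖) * (‖q.1‖ * ‖q.1‖⁻¹) *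
        (bracket (k + q.1) ^ (-(2 * m)) * (bracket (k + q.1) ^ m) ^ 2) *
        (bracket (k + aMap q.2 q.1) ^ (-(2 * m)) * (bracket (k + aMap q.2 q.1) ^ m) ^ 2) := by ring
    _ = ‖q.1‖ ^ 2 := by
        rw [e1, e2, inv_mul_cancel₀ hap.ne', mul_inv_cancel₀ hzp.ne']; ring

/-- The bound `lintegral_frequency_le` with `k₁^*` instead of `k^*`. -/
theorem lintegral_frequency_le' {m : ℝ} (hm : 1 / 2 < m) {f g : R3 → ℝ≥0∞} (hf : Measurable f)
    (hg : Measurable g) (k : R3) :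
    ∫⁻ p, ENNReal.ofReal ‖k - p.1‖ * (f p.1 * g (kOneStar k p.1 p.2)) ∂resonantMeasure ≤
      frequencyConst m * (weightedSq m f ^ (1 / 2 : ℝ) * weightedSq m g ^ (1 / 2 : ℝ)) := by
  refine le_trans (le_of_eq ?_) (lintegral_frequency_le hm hf hg k)
  rw [← lintegral_resonant_neg (fun p => ENNReal.ofReal ‖k - p.1‖ * (f p.1 * g (kStar k p.1 p.2)))
    (by fun_prop)]
  simp only [kStar_neg]

/-- The factor of `f(k)` in the gain term is bounded uniformly in `k`. The Cauchy-Schwarz weights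
are `|a| |z| |b|⁻¹ ⟨k₁^*⟩^{-2m} ⟨k^*⟩^{2m}` with `b = z - a = k₁^* - k`, and the same with `a` and
`b` exchanged; for fixed `a`, the point `b` runs through the plane orthogonal to `a`. -/
theorem lintegral_gain_factor_le {m : ℝ} (hm : 1 / 2 < m) {f g : R3 → ℝ≥0∞} (hf : Measurable f)
    (hg : Measurable g) (k : R3) :
    ∫⁻ p, ENNReal.ofReal ‖k - p.1‖ * (f (kStar k p.1 p.2) * g (kOneStar k p.1 p.2))
      ∂resonantMeasure ≤
      frequencyConst m * (weightedSq m f ^ (1 / 2 : ℝ) * weightedSq m g ^ (1 / 2 : ℝ)) := by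
  rw [lintegral_resonant_translate k _ (by fun_prop)]
  have hn : ∀ z : R3, ‖k - (k + z)‖ = ‖z‖ := fun z => by rw [sub_add_cancel_left, norm_neg]
  simp only [kStar_add, kOneStar_add, hn]
  have ha := measurable_displacement
  set P : R3 × S2 → ℝ≥0∞ := fun q => ENNReal.ofReal (‖aMap q.2 q.1‖ * ‖q.1‖ *
      (‖q.1 - (1 : ℝ) • aMap q.2 q.1‖⁻¹ *
      bracket (k + (q.1 - (1 : ℝ) • aMap q.2 q.1)) ^ (-(2 * m)))) *
        (ENNReal.ofReal (bracket (k + aMap q.2 q.1) ^ m) * f (k + aMap q.2 q.1)) ^ 2 with hP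
  set Q' : R3 × S2 → ℝ≥0∞ := fun q => ENNReal.ofReal (‖aMap q.2 q.1‖ * ‖q.1‖ *
      (‖q.1 - (1 : ℝ) • aMap q.2 q.1‖⁻¹ *
      bracket (k + (q.1 - (1 : ℝ) • aMap q.2 q.1)) ^ (-(2 * m)))) *
        (ENNReal.ofReal (bracket (k + aMap q.2 q.1) ^ m) * g (k + aMap q.2 q.1)) ^ 2 with hQ
  have hPm : Measurable P := (measurable_singular m 1 k).mul
    (((measurable_weighted hf).comp (measurable_const_add k)).comp ha)
  have hQm : Measurable Q' := (measurable_singular m 1 k).mul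
    (((measurable_weighted hg).comp (measurable_const_add k)).comp ha)
  have hnegm : Measurable fun q : R3 × S2 => (q.1, -q.2) := by fun_prop
  have hQi : ∫⁻ q, Q' (q.1, -q.2) ∂resonantMeasure ≤ frequencyConst m * weightedSq m g :=
    (lintegral_resonant_neg Q' hQm).trans_le (lintegral_singular_le hm hg k 1)
  refine (lintegral_le_sqrt_mul_sqrt hPm.aemeasurable (hQm.comp hnegm).aemeasurable ?_).trans
    (sqrt_mul_sqrt_le (lintegral_singular_le hm hf k 1) hQi)
  have hneg : ∀ᵐ q : R3 × S2 ∂resonantMeasure, q.1 ≠ 0 → aMap (-q.2 : S2) q.1 ≠ 0 :=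
    (((MeasurePreserving.id volume).prod measurePreserving_neg_surf).quasiMeasurePreserving.ae
      ae_aMap_ne_zero)
  filter_upwards [ae_aMap_ne_zero, hneg] with q hq hq'
  by_cases hz : q.1 = 0
  · simp [hz]
  have hab : aMap (-q.2 : S2) q.1 = q.1 - aMap q.2 q.1 := (sub_aMap _ _).symm
  have hba : q.1 - (q.1 - aMap q.2 q.1) = aMap q.2 q.1 := by abel
  have hap : 0 < ‖aMap q.2 q.1‖ := norm_pos_iff.2 (hq hz)
  have hbp : 0 < ‖q.1 - aMap q.2 q.1‖ := norm_pos_iff.2 (hab ▸ hq' hz)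
  simp only [hP, hQ, Function.comp_apply, one_smul, hab, hba]
  have hb1 : 0 < bracket (k + aMap q.2 q.1) := bracket_pos _
  have hb2 : 0 < bracket (k + (q.1 - aMap q.2 q.1)) := bracket_pos _
  refine sq_ofReal_mul_le (by positivity) (by positivity) (by positivity) (by positivity) ?_ _ _
  have e1 := bracket_rpow_cancel m (k + aMap q.2 q.1)
  have e2 := bracket_rpow_cancel m (k + (q.1 - aMap q.2 q.1))
  set a := aMap q.2 q.1
  calc _ = ‖q.1‖ ^ 2 * (‖a‖ * ‖a‖⁻¹) * (‖q.1 - a‖ * ‖q.1 - a‖⁻¹) *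
        (bracket (k + a) ^ (-(2 * m)) * (bracket (k + a) ^ m) ^ 2) *
        (bracket (k + (q.1 - a)) ^ (-(2 * m)) * (bracket (k + (q.1 - a)) ^ m) ^ 2) := by ring
    _ = ‖q.1‖ ^ 2 := by
        rw [e1, e2, mul_inv_cancel₀ hap.ne', mul_inv_cancel₀ hbp.ne']; ring

/-! ### The exchange of pre- and post-collisional variables -/

/-- The measure `dw dσ` is symmetric under the exchange of the vectors `w` and `|w| σ` of equal
length. -/
theorem lintegral_swap_directions {Ψ : R3 → R3 → ℝ≥0∞} (hΨ : Measurable (Function.uncurry Ψ)) :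
    ∫⁻ w : R3, (∫⁻ σ : S2, Ψ w (‖w‖ • (σ : R3)) ∂surf) =
      ∫⁻ w : R3, (∫⁻ σ : S2, Ψ (‖w‖ • (σ : R3)) w ∂surf) := by
  have key : ∀ Ψ : R3 → R3 → ℝ≥0∞, Measurable (Function.uncurry Ψ) →
      ∫⁻ w : R3, (∫⁻ σ : S2, Ψ w (‖w‖ • (σ : R3)) ∂surf) =
      ∫⁻ t in Ioi (0 : ℝ), ENNReal.ofReal (t ^ 2) *
        ∫⁻ ω : S2, (∫⁻ σ : S2, Ψ (t • (ω : R3)) (t • (σ : R3)) ∂surf) ∂surf := by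
    intro Ψ hΨ
    have hm : Measurable fun q : R3 × S2 => Ψ q.1 (‖q.1‖ • (q.2 : R3)) :=
      hΨ.comp (measurable_fst.prodMk (by fun_prop))
    have hm2 : Measurable fun q : (S2 × ℝ) × S2 => Ψ (q.1.2 • (q.1.1 : R3)) (q.1.2 • (q.2 : R3)) :=
      hΨ.comp (Measurable.prodMk (by fun_prop) (by fun_prop))
    rw [lintegral_polar hm.lintegral_prod_right']
    have h1 : ∀ σ : S2, (∫⁻ t in Ioi (0 : ℝ), ENNReal.ofReal (t ^ 2) *
        ∫⁻ σ' : S2, Ψ (t • (σ : R3)) (‖t • (σ : R3)‖ • (σ' : R3)) ∂surf) =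
        ∫⁻ t in Ioi (0 : ℝ), ENNReal.ofReal (t ^ 2) *
        ∫⁻ σ' : S2, Ψ (t • (σ : R3)) (t • (σ' : R3)) ∂surf := by
      intro σ
      refine setLIntegral_congr_fun measurableSet_Ioi fun t ht => ?_
      have ht : 0 < t := ht
      have hn : ‖t • (σ : R3)‖ = t := by
        rw [norm_smul, norm_eq_of_mem_sphere σ, mul_one, Real.norm_of_nonneg ht.le]
      simp only [hn]
    simp only [h1]
    have hm3 : Measurable fun q : S2 × ℝ => ∫⁻ σ' : S2, Ψ (q.2 • (q.1 : R3)) (q.2 • (σ' : R3)) ∂surf :=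
      hm2.lintegral_prod_right'
    rw [lintegral_lintegral_swap]
    · refine lintegral_congr fun t => ?_
      have hm4 : Measurable fun σ : S2 => ∫⁻ σ' : S2, Ψ (t • (σ : R3)) (t • (σ' : R3)) ∂surf :=
        hm3.comp measurable_prodMk_right
      rw [lintegral_const_mul _ hm4]
    · exact (Measurable.mul (by fun_prop) hm3).aemeasurable
  rw [key Ψ hΨ, key (fun x y => Ψ y x) (hΨ.comp measurable_swap)]
  refine lintegral_congr fun t => ?_
  congr 1
  refine lintegral_lintegral_swap ?_
  exact (hΨ.comp (Measurable.prodMk (by fun_prop) (by fun_prop))).aemeasurable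

/-- The change between pre- and post-collisional variables: in terms of the centre of mass
`K = (k + k₁)/2` and the relative wave number `w = k - k₁`, it exchanges `w` and `|w| σ`. -/
theorem lintegral_collision_swap {Φ : R3 × R3 × R3 × R3 → ℝ≥0∞} (hΦ : Measurable Φ) :
    ∫⁻ k : R3, (∫⁻ p, Φ (k, p.1, kStar k p.1 p.2, kOneStar k p.1 p.2) ∂resonantMeasure) =
      ∫⁻ k : R3, (∫⁻ p, Φ (kOneStar k p.1 p.2, kStar k p.1 p.2, p.1, k) ∂resonantMeasure) := by
  have key : ∀ Φ : R3 × R3 × R3 × R3 → ℝ≥0∞, Measurable Φ →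
      ∫⁻ k : R3, (∫⁻ p, Φ (k, p.1, kStar k p.1 p.2, kOneStar k p.1 p.2) ∂resonantMeasure) =
      ∫⁻ K : R3, (∫⁻ w : R3, (∫⁻ σ : S2, Φ (K + (1 / 2 : ℝ) • w, K - (1 / 2 : ℝ) • w,
        K - (1 / 2 : ℝ) • (‖w‖ • (σ : R3)), K + (1 / 2 : ℝ) • (‖w‖ • (σ : R3))) ∂surf)) := by
    intro Φ hΦ
    have e1 : ∀ k : R3,
        (∫⁻ p, Φ (k, p.1, kStar k p.1 p.2, kOneStar k p.1 p.2) ∂resonantMeasure) =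
        ∫⁻ w : R3, (∫⁻ σ : S2, Φ (k, k - w, kStar k (k - w) σ, kOneStar k (k - w) σ) ∂surf) := by
      intro k
      have hm : Measurable fun p : R3 × S2 => Φ (k, p.1, kStar k p.1 p.2, kOneStar k p.1 p.2) := by
        fun_prop
      rw [resonantMeasure, lintegral_prod _ hm.aemeasurable]
      exact (lintegral_sub_left_eq_self (fun x : R3 => ∫⁻ σ : S2,
        Φ (k, x, kStar k x σ, kOneStar k x σ) ∂surf) k).symm
    have hm : Measurable fun q : (R3 × R3) × S2 =>
        Φ (q.1.1, q.1.1 - q.1.2, kStar q.1.1 (q.1.1 - q.1.2) q.2,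
          kOneStar q.1.1 (q.1.1 - q.1.2) q.2) := by fun_prop
    have hm' : Measurable fun q : (R3 × R3) × S2 =>
        Φ (q.1.1 + (1 / 2 : ℝ) • q.1.2, q.1.1 - (1 / 2 : ℝ) • q.1.2,
        q.1.1 - (1 / 2 : ℝ) • (‖q.1.2‖ • (q.2 : R3)),
        q.1.1 + (1 / 2 : ℝ) • (‖q.1.2‖ • (q.2 : R3))) := by fun_prop
    simp only [e1]
    refine (lintegral_lintegral_swap (f := fun k w => ∫⁻ σ : S2,
      Φ (k, k - w, kStar k (k - w) σ, kOneStar k (k - w) σ) ∂surf)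
      hm.lintegral_prod_right'.aemeasurable).trans (Eq.trans ?_ (lintegral_lintegral_swap
      (f := fun K w => ∫⁻ σ : S2, Φ (K + (1 / 2 : ℝ) • w, K - (1 / 2 : ℝ) • w,
        K - (1 / 2 : ℝ) • (‖w‖ • (σ : R3)), K + (1 / 2 : ℝ) • (‖w‖ • (σ : R3))) ∂surf)
      hm'.lintegral_prod_right'.aemeasurable).symm)
    refine lintegral_congr fun w => ?_
    rw [← lintegral_add_right_eq_self _ ((1 / 2 : ℝ) • w)]
    refine lintegral_congr fun K => lintegral_congr fun σ => ?_
    have hw : K + (1 / 2 : ℝ) • w - w = K - (1 / 2 : ℝ) • w := by module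
    have hd : K + (1 / 2 : ℝ) • w - (K - (1 / 2 : ℝ) • w) = w := by module
    rw [hw, kStar, kOneStar, hd]
    congr 1
    refine Prod.ext rfl (Prod.ext rfl (Prod.ext ?_ ?_)) <;> simp only <;> module
  rw [key Φ hΦ]
  have := key (fun x => Φ (x.2.2.2, x.2.2.1, x.2.1, x.1)) (by fun_prop)
  simp only at this
  rw [this]
  refine lintegral_congr fun K => ?_
  exact lintegral_swap_directions (Ψ := fun x y => Φ (K + (1 / 2 : ℝ) • x, K - (1 / 2 : ℝ) • x,
    K - (1 / 2 : ℝ) • y, K + (1 / 2 : ℝ) • y)) (by unfold Function.uncurry; fun_prop)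

/-! ### The gain term on weighted Lebesgue spaces -/

@[fun_prop]
theorem measurable_bracket : Measurable bracket := continuous_bracket.measurable

/-- Interpolation between `L¹` and `L^∞` for positive operators. For `r < ∞` this is Jensen's
inequality with respect to the measures `W x y dν(y)`; for `r = ∞` the `L¹` bound is still needed,
to see that `φ x y` avoids null sets. -/
theorem eLpNorm_positive_operator_le {X Y : Type*} [MeasurableSpace X] [MeasurableSpace Y]
    {μ : Measure X} {ν : Measure Y} [SFinite ν] {W : X → Y → ℝ≥0∞}
    (hW : Measurable (Function.uncurry W)) {φ : X → Y → X}
    (hφ : Measurable (Function.uncurry φ)) {M : ℝ≥0∞} (h1 : ∀ x, ∫⁻ y, W x y ∂ν ≤ M)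
    (h2 : ∀ F : X → ℝ≥0∞, Measurable F →
      ∫⁻ x, (∫⁻ y, W x y * F (φ x y) ∂ν) ∂μ ≤ M * ∫⁻ x, F x ∂μ)
    {r : ℝ≥0∞} (hr : 1 ≤ r) {F : X → ℝ≥0∞} (hF : Measurable F) :
    eLpNorm (fun x => ∫⁻ y, W x y * F (φ x y) ∂ν) r μ ≤ M * eLpNorm F r μ := by
  have hWx : ∀ x, Measurable (W x) := fun x => hW.comp measurable_prodMk_left
  have hφx : ∀ x, Measurable (φ x) := fun x => hφ.comp measurable_prodMk_left
  have hWF : ∀ F : X → ℝ≥0∞, Measurable F →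
      Measurable fun q : X × Y => W q.1 q.2 * F (φ q.1 q.2) := fun F hF => hW.mul (hF.comp hφ)
  rcases eq_or_ne r ∞ with rfl | hrt
  · rw [eLpNorm_exponent_top, eLpNorm_exponent_top]
    set c := eLpNormEssSup F μ with hc
    set N : Set X := {x | c < F x} with hN
    have hNm : MeasurableSet N := measurableSet_lt measurable_const hF
    have hN0 : μ N = 0 := by
      have := enorm_ae_le_eLpNormEssSup F μ
      rw [ae_iff] at this
      simpa [hN, hc] using this
    -- The `L¹` bound for `∞ · 1_N` shows that `φ x y` avoids the null set `N` for almost every `x`.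
    have hI : Measurable (N.indicator fun _ => (∞ : ℝ≥0∞)) := measurable_const.indicator hNm
    have h3 := h2 _ hI
    rw [lintegral_indicator_const hNm, hN0, mul_zero, mul_zero, nonpos_iff_eq_zero,
      lintegral_eq_zero_iff (hWF _ hI).lintegral_prod_right'] at h3
    refine eLpNormEssSup_le_of_ae_enorm_bound ?_
    filter_upwards [h3] with x hx
    rw [enorm_eq_self]
    calc ∫⁻ y, W x y * F (φ x y) ∂ν
        ≤ ∫⁻ y, (W x y * c + W x y * N.indicator (fun _ => (∞ : ℝ≥0∞)) (φ x y)) ∂ν := by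
          refine lintegral_mono fun y => ?_
          rw [← mul_add]
          refine mul_le_mul_right ?_ _
          by_cases hy : φ x y ∈ N
          · simp [hy]
          · exact (not_lt.1 hy).trans le_self_add
      _ ≤ M * c := by
          rw [lintegral_add_left ((hWx x).mul_const c), lintegral_mul_const _ (hWx x)]
          have hx : ∫⁻ y, W x y * N.indicator (fun _ => (∞ : ℝ≥0∞)) (φ x y) ∂ν = 0 := hx
          rw [hx, add_zero]
          exact mul_le_mul_left (h1 x) _
  · have hr0 : r ≠ 0 := (zero_lt_one.trans_le hr).ne'
    set p := r.toReal with hp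
    have hp1 : 1 ≤ p := by
      rw [hp, ← ENNReal.toReal_one]; exact ENNReal.toReal_mono hrt hr
    have hp0 : 0 < p := by linarith
    have hq0 : 0 ≤ 1 - 1 / p := by
      rw [sub_nonneg, div_le_one hp0]; exact hp1
    have hpw : ∀ x, (∫⁻ y, W x y * F (φ x y) ∂ν) ^ p ≤
        M ^ (p - 1) * ∫⁻ y, W x y * F (φ x y) ^ p ∂ν := by
      intro x
      have hH := ENNReal.lintegral_mul_norm_pow_le (μ := ν) (hWx x).aemeasurable
        ((hWx x).mul ((hF.comp (hφx x)).pow_const p)).aemeasurable hq0 (by positivity : 0 ≤ 1 / p)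
        (by ring)
      have heq : ∀ y, W x y ^ (1 - 1 / p) * ((W x * fun y => (F ∘ φ x) y ^ p) y) ^ (1 / p) =
          W x y * F (φ x y) := by
        intro y
        rw [Pi.mul_apply, ENNReal.mul_rpow_of_nonneg _ _ (by positivity), ← mul_assoc,
          ← ENNReal.rpow_add_of_nonneg _ _ hq0 (by positivity), ← ENNReal.rpow_mul,
          mul_one_div_cancel hp0.ne']
        simp
      simp only [heq] at hH
      calc _ ≤ ((∫⁻ y, W x y ∂ν) ^ (1 - 1 / p) *
            (∫⁻ y, W x y * F (φ x y) ^ p ∂ν) ^ (1 / p)) ^ p := ENNReal.rpow_le_rpow hH hp0.le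
        _ = (∫⁻ y, W x y ∂ν) ^ (p - 1) * ∫⁻ y, W x y * F (φ x y) ^ p ∂ν := by
            rw [ENNReal.mul_rpow_of_nonneg _ _ hp0.le, ← ENNReal.rpow_mul, ← ENNReal.rpow_mul,
              one_div_mul_cancel hp0.ne', ENNReal.rpow_one]
            congr 2
            field_simp
        _ ≤ _ := mul_le_mul_left (ENNReal.rpow_le_rpow (h1 x) (by linarith)) _
    rw [eLpNorm_eq_lintegral_rpow_enorm_toReal hr0 hrt, eLpNorm_eq_lintegral_rpow_enorm_toReal hr0 hrt]
    simp only [enorm_eq_self, ← hp]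
    have hFp : Measurable fun x => F x ^ p := hF.pow_const p
    calc _ ≤ (M ^ (p - 1) * (M * ∫⁻ x, F x ^ p ∂μ)) ^ (1 / p) := by
          refine ENNReal.rpow_le_rpow ?_ (by positivity)
          refine (lintegral_mono hpw).trans ?_
          rw [lintegral_const_mul _ (hWF _ hFp).lintegral_prod_right']
          exact mul_le_mul_right (h2 _ hFp) _
      _ = (M ^ p * ∫⁻ x, F x ^ p ∂μ) ^ (1 / p) := by
          rw [← mul_assoc]
          congr 2
          nth_rewrite 2 [← ENNReal.rpow_one M]
          rw [← ENNReal.rpow_add_of_nonneg _ _ (by linarith) zero_le_one, sub_add_cancel]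
      _ = _ := by
          rw [ENNReal.mul_rpow_of_nonneg _ _ (by positivity), ← ENNReal.rpow_mul,
            mul_one_div_cancel hp0.ne', ENNReal.rpow_one]

theorem norm_kOneStar_sub_kStar (k k₁ : R3) (σ : S2) :
    ‖kOneStar k k₁ σ - kStar k k₁ σ‖ = ‖k - k₁‖ := by
  have : kOneStar k k₁ σ - kStar k k₁ σ = ‖k - k₁‖ • (σ : R3) := by
    rw [kOneStar, kStar]; module
  rw [this, norm_smul, norm_eq_of_mem_sphere σ, norm_norm, mul_one]

theorem norm_sq_kStar_add (k k₁ : R3) (σ : S2) :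
    ‖kStar k k₁ σ‖ ^ 2 + ‖kOneStar k k₁ σ‖ ^ 2 = ‖k‖ ^ 2 + ‖k₁‖ ^ 2 := by
  have h1 := parallelogram_law_with_norm ℝ ((1 / 2 : ℝ) • (k + k₁)) ((‖k - k₁‖ / 2) • (σ : R3))
  have h2 := parallelogram_law_with_norm ℝ k k₁
  have h3 : ‖(1 / 2 : ℝ) • (k + k₁)‖ = ‖k + k₁‖ / 2 := by
    rw [norm_smul]; norm_num; ring
  have h4 : ‖(‖k - k₁‖ / 2) • (σ : R3)‖ = ‖k - k₁‖ / 2 := by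
    rw [norm_smul, norm_eq_of_mem_sphere σ, mul_one, Real.norm_of_nonneg (by positivity)]
  rw [h3, h4] at h1
  rw [kStar, kOneStar]
  nlinarith

/-- Conservation of energy lets one of the outgoing wave numbers carry the weight of `k`. -/
theorem bracket_rpow_le (k k₁ : R3) (σ : S2) {l : ℝ} (hl : 0 ≤ l) :
    bracket k ^ l ≤ 2 ^ l * (bracket (kStar k k₁ σ) ^ l + bracket (kOneStar k k₁ σ) ^ l) := by
  set x := bracket (kStar k k₁ σ)
  set y := bracket (kOneStar k k₁ σ)
  have hx : 0 < x := bracket_pos _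
  have hy : 0 < y := bracket_pos _
  have h1 : bracket k ≤ x + y := by
    have hsq : ∀ k, bracket k ^ 2 = 1 + ‖k‖ ^ 2 := fun k => Real.sq_sqrt (by positivity)
    refine abs_le_of_sq_le_sq' ?_ (by positivity) |>.2
    have := norm_sq_kStar_add k k₁ σ
    have hx2 : x ^ 2 = _ := hsq _
    have hy2 : y ^ 2 = _ := hsq _
    rw [hsq]
    nlinarith [sq_nonneg ‖k₁‖, mul_pos hx hy]
  have h2 : x + y ≤ 2 * max x y := by
    have := le_max_left x y
    have := le_max_right x y
    linarith
  calc bracket k ^ l ≤ (2 * max x y) ^ l := Real.rpow_le_rpow (bracket_pos k).le (h1.trans h2) hl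
    _ = 2 ^ l * (max x y) ^ l := Real.mul_rpow (by norm_num) (by positivity)
    _ ≤ _ := by
        gcongr
        rcases max_choice x y with h | h <;> rw [h]
        · linarith [Real.rpow_nonneg hy.le l]
        · linarith [Real.rpow_nonneg hx.le l]

/-- The weighted norm `‖⟨k⟩^l f‖_{L^r}` of a nonnegative function. -/
def weightedNorm (l : ℝ) (r : ℝ≥0∞) (f : R3 → ℝ≥0∞) : ℝ≥0∞ :=
  eLpNorm (fun k => ENNReal.ofReal (bracket k ^ l) * f k) r volume

/-- The weighted norm `‖⟨k⟩^m f‖_{L²}`. -/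
def weightedL2 (m : ℝ) (f : R3 → ℝ≥0∞) : ℝ≥0∞ := weightedSq m f ^ (1 / 2 : ℝ)

/-- The part `∫ |w| f(k₁) g(k^*) h(k₁^*)` of the gain term. -/
def gainPart (f g h : R3 → ℝ≥0∞) (k : R3) : ℝ≥0∞ :=
  ∫⁻ p, ENNReal.ofReal ‖k - p.1‖ * (f p.1 * h (kOneStar k p.1 p.2)) * g (kStar k p.1 p.2)
    ∂resonantMeasure

theorem measurable_gainPart {f g h : R3 → ℝ≥0∞} (hf : Measurable f) (hg : Measurable g)
    (hh : Measurable h) : Measurable (gainPart f g h) := by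
  unfold gainPart
  exact Measurable.lintegral_prod_right' (f := fun q : R3 × (R3 × S2) =>
    ENNReal.ofReal ‖q.1 - q.2.1‖ * (f q.2.1 * h (kOneStar q.1 q.2.1 q.2.2)) *
      g (kStar q.1 q.2.1 q.2.2)) (by fun_prop)

theorem gainPart_comm {f g h : R3 → ℝ≥0∞} (hf : Measurable f) (hg : Measurable g)
    (hh : Measurable h) : gainPart f g h = gainPart f h g := by
  funext k
  unfold gainPart
  rw [← lintegral_resonant_neg _ (by fun_prop)]
  refine lintegral_congr fun p => ?_
  have h1 : kOneStar k p.1 (-p.2) = kStar k p.1 p.2 := by rw [← kStar_neg, neg_neg]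
  rw [kStar_neg, h1]
  ring

/-- The gain term is bounded on `L¹` as an operator on the function of `k^*`: in post-collisional
variables, its integral is that of `F` against a collision frequency. -/
theorem lintegral_gainPart_le {m : ℝ} (hm : 1 / 2 < m) {f h F : R3 → ℝ≥0∞} (hf : Measurable f)
    (hh : Measurable h) (hF : Measurable F) :
    ∫⁻ k, gainPart f F h k ≤
      frequencyConst m * (weightedL2 m f * weightedL2 m h) * ∫⁻ k, F k := by
  have hs := lintegral_collision_swap (Φ := fun x =>
    ENNReal.ofReal ‖x.1 - x.2.1‖ * (f x.2.1 * h x.2.2.2) * F x.2.2.1) (by fun_prop)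
  simp only at hs
  unfold gainPart
  rw [hs]
  simp only [norm_kOneStar_sub_kStar]
  have hm1 : Measurable fun q : (R3 × R3) × S2 =>
      ENNReal.ofReal ‖q.1.1 - q.1.2‖ * (f (kStar q.1.1 q.1.2 q.2) * h q.1.1) * F q.1.2 := by fun_prop
  have e1 : ∀ k : R3, (∫⁻ p, ENNReal.ofReal ‖k - p.1‖ * (f (kStar k p.1 p.2) * h k) * F p.1
      ∂resonantMeasure) = ∫⁻ k₁ : R3, (∫⁻ σ : S2,
        ENNReal.ofReal ‖k - k₁‖ * (f (kStar k k₁ σ) * h k) * F k₁ ∂surf) := by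
    intro k
    have hm2 : Measurable fun p : R3 × S2 =>
        ENNReal.ofReal ‖k - p.1‖ * (f (kStar k p.1 p.2) * h k) * F p.1 := by fun_prop
    rw [resonantMeasure, lintegral_prod _ hm2.aemeasurable]
  simp only [e1]
  rw [lintegral_lintegral_swap (f := fun k k₁ => ∫⁻ σ : S2,
        ENNReal.ofReal ‖k - k₁‖ * (f (kStar k k₁ σ) * h k) * F k₁ ∂surf)
        hm1.lintegral_prod_right'.aemeasurable, ← lintegral_const_mul _ hF]
  refine lintegral_mono fun k₁ => ?_
  have hm3 : Measurable fun p : R3 × S2 =>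
      ENNReal.ofReal ‖k₁ - p.1‖ * (h p.1 * f (kStar k₁ p.1 p.2)) := by fun_prop
  have h4 := lintegral_frequency_le hm hh hf k₁
  rw [resonantMeasure, lintegral_prod _ hm3.aemeasurable] at h4
  calc _ = (∫⁻ k : R3, (∫⁻ σ : S2,
        ENNReal.ofReal ‖k₁ - k‖ * (h k * f (kStar k₁ k σ)) ∂surf)) * F k₁ := by
        rw [← lintegral_mul_const _ hm3.lintegral_prod_right']
        refine lintegral_congr fun k => ?_
        have hm5 : Measurable fun σ : S2 =>
          ENNReal.ofReal ‖k₁ - k‖ * (h k * f (kStar k₁ k σ)) := by fun_prop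
        rw [← lintegral_mul_const _ hm5]
        refine lintegral_congr fun σ => ?_
        rw [norm_sub_rev, kStar_comm, mul_comm (h k)]
    _ ≤ _ := by
        refine mul_le_mul_left (h4.trans_eq ?_) _
        rw [mul_comm (weightedL2 m f)]; rfl

theorem eLpNorm_gainPart_le {m : ℝ} (hm : 1 / 2 < m) {r : ℝ≥0∞} (hr : 1 ≤ r) {f h F : R3 → ℝ≥0∞}
    (hf : Measurable f) (hh : Measurable h) (hF : Measurable F) :
    eLpNorm (gainPart f F h) r volume ≤
      frequencyConst m * (weightedL2 m f * weightedL2 m h) * eLpNorm F r volume :=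
  eLpNorm_positive_operator_le (μ := (volume : Measure R3)) (ν := resonantMeasure)
    (W := fun k p => ENNReal.ofReal ‖k - p.1‖ * (f p.1 * h (kOneStar k p.1 p.2)))
    (by unfold Function.uncurry; fun_prop) (φ := fun k p => kStar k p.1 p.2)
    (by unfold Function.uncurry; fun_prop) (lintegral_frequency_le' hm hf hh)
    (fun F hF => lintegral_gainPart_le hm hf hh hF) hr hF

/-- The weight `⟨k⟩^l` is moved to one of the functions of `k^*` and `k₁^*`, and the operator acting
on that function is bounded on `L^r`. -/
theorem weightedNorm_gainPart_le {m : ℝ} (hm : 1 / 2 < m) {r : ℝ≥0∞} (hr : 1 ≤ r) {l : ℝ}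
    (hl : 0 ≤ l) {f g h : R3 → ℝ≥0∞} (hf : Measurable f) (hg : Measurable g) (hh : Measurable h) :
    weightedNorm l r (gainPart f g h) ≤ ENNReal.ofReal (2 ^ l) * frequencyConst m *
      (weightedL2 m f * weightedL2 m h * weightedNorm l r g +
        weightedL2 m f * weightedL2 m g * weightedNorm l r h) := by
  have hb := (measurable_bracket_rpow l).ennreal_ofReal
  have hgb : Measurable fun k => ENNReal.ofReal (bracket k ^ l) * g k := hb.mul hg
  have hhb : Measurable fun k => ENNReal.ofReal (bracket k ^ l) * h k := hb.mul hh
  have hpt : ∀ k, ENNReal.ofReal (bracket k ^ l) * gainPart f g h k ≤ ENNReal.ofReal (2 ^ l) *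
      (gainPart f (fun k => ENNReal.ofReal (bracket k ^ l) * g k) h k +
        gainPart f (fun k => ENNReal.ofReal (bracket k ^ l) * h k) g k) := by
    intro k
    rw [gainPart_comm hf hhb hg]
    unfold gainPart
    rw [← lintegral_const_mul _ (by fun_prop), ← lintegral_add_left (by fun_prop),
      ← lintegral_const_mul _ (by fun_prop)]
    refine lintegral_mono fun p => ?_
    set x := kStar k p.1 p.2
    set y := kOneStar k p.1 p.2
    have h1 : ENNReal.ofReal (bracket k ^ l) ≤ ENNReal.ofReal (2 ^ l) *
        (ENNReal.ofReal (bracket x ^ l) + ENNReal.ofReal (bracket y ^ l)) := by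
      rw [← ENNReal.ofReal_add (Real.rpow_nonneg (bracket_pos _).le _)
        (Real.rpow_nonneg (bracket_pos _).le _), ← ENNReal.ofReal_mul (by positivity)]
      exact ENNReal.ofReal_le_ofReal (bracket_rpow_le k p.1 p.2 hl)
    calc _ ≤ (ENNReal.ofReal (2 ^ l) *
        (ENNReal.ofReal (bracket x ^ l) + ENNReal.ofReal (bracket y ^ l))) *
          (ENNReal.ofReal ‖k - p.1‖ * (f p.1 * h y) * g x) := mul_le_mul_left h1 _
      _ = _ := by ring
  have hm1 := measurable_gainPart hf hgb hh
  have hm2 := measurable_gainPart hf hhb hg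
  unfold weightedNorm
  calc _ ≤ ENNReal.ofReal (2 ^ l) *
        eLpNorm (gainPart f (fun k => ENNReal.ofReal (bracket k ^ l) * g k) h +
          gainPart f (fun k => ENNReal.ofReal (bracket k ^ l) * h k) g) r volume := by
        refine eLpNorm_le_mul_eLpNorm_of_ae_le_mul'' _ (hm1.add hm2).aestronglyMeasurable ?_
        exact Filter.Eventually.of_forall fun k => by simpa using hpt k
    _ ≤ ENNReal.ofReal (2 ^ l) *
        (frequencyConst m * (weightedL2 m f * weightedL2 m h) * weightedNorm l r g +
        frequencyConst m * (weightedL2 m f * weightedL2 m g) * weightedNorm l r h) := by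
        refine mul_le_mul_right ((eLpNorm_add_le hm1.aestronglyMeasurable
          hm2.aestronglyMeasurable hr).trans (add_le_add ?_ ?_)) _
        · exact eLpNorm_gainPart_le hm hr hf hh hgb
        · exact eLpNorm_gainPart_le hm hr hf hg hhb
    _ = _ := by unfold weightedNorm; ring

/-- The sum of the absolute values of the four trilinear terms in the collision operator. -/
def collisionBound (f g h : R3 → ℝ≥0∞) (k : R3) : ℝ≥0∞ :=
  ∫⁻ p, ENNReal.ofReal ‖k - p.1‖ * (g (kStar k p.1 p.2) * h (kOneStar k p.1 p.2) * (f k + f p.1) +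
    f k * g p.1 * (h (kStar k p.1 p.2) + h (kOneStar k p.1 p.2))) ∂resonantMeasure

/-- The trilinear estimate, with two of the three functions in weighted `L²` spaces. -/
theorem weightedNorm_collisionBound_le {m : ℝ} (hm : 1 / 2 < m) {r : ℝ≥0∞} (hr : 1 ≤ r) {l : ℝ}
    (hl : 0 ≤ l) {f g h : R3 → ℝ≥0∞} (hf : Measurable f) (hg : Measurable g) (hh : Measurable h) :
    weightedNorm l r (collisionBound f g h) ≤
      3 * frequencyConst m * (weightedL2 m g * weightedL2 m h) * weightedNorm l r f +
      ENNReal.ofReal (2 ^ l) * frequencyConst m *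
      (weightedL2 m f * weightedL2 m h * weightedNorm l r g +
        weightedL2 m f * weightedL2 m g * weightedNorm l r h) := by
  set c := 3 * frequencyConst m * (weightedL2 m g * weightedL2 m h) with hc
  have hpt : ∀ k, collisionBound f g h k ≤ c * f k + gainPart f g h k := by
    intro k
    have h1 := lintegral_gain_factor_le hm hg hh k
    have h2 := lintegral_frequency_le hm hg hh k
    have h3 := lintegral_frequency_le' hm hg hh k
    calc collisionBound f g h k = (∫⁻ p, ENNReal.ofReal ‖k - p.1‖ *
            (g (kStar k p.1 p.2) * h (kOneStar k p.1 p.2)) ∂resonantMeasure) * f k +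
          (∫⁻ p, ENNReal.ofReal ‖k - p.1‖ * (g p.1 * h (kStar k p.1 p.2)) ∂resonantMeasure) * f k +
          (∫⁻ p, ENNReal.ofReal ‖k - p.1‖ * (g p.1 * h (kOneStar k p.1 p.2))
            ∂resonantMeasure) * f k + gainPart f g h k := by
          unfold collisionBound gainPart
          rw [← lintegral_mul_const _ (by fun_prop), ← lintegral_mul_const _ (by fun_prop),
            ← lintegral_mul_const _ (by fun_prop), ← lintegral_add_left (by fun_prop),
            ← lintegral_add_left (by fun_prop), ← lintegral_add_left (by fun_prop)]
          refine lintegral_congr fun p => ?_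
          ring
      _ ≤ _ := by
          refine add_le_add_left ?_ _
          rw [← add_mul, ← add_mul]
          refine mul_le_mul_left ((add_le_add (add_le_add h1 h2) h3).trans_eq ?_) _
          rw [hc]; unfold weightedL2; ring
  have hb := (measurable_bracket_rpow l).ennreal_ofReal
  have hm1 : Measurable fun k => c * (ENNReal.ofReal (bracket k ^ l) * f k) :=
    (hb.mul hf).const_mul c
  have hm2 : Measurable fun k => ENNReal.ofReal (bracket k ^ l) * gainPart f g h k :=
    hb.mul (measurable_gainPart hf hg hh)
  calc weightedNorm l r (collisionBound f g h)
      ≤ eLpNorm ((fun k => c * (ENNReal.ofReal (bracket k ^ l) * f k)) +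
        fun k => ENNReal.ofReal (bracket k ^ l) * gainPart f g h k) r volume := by
        refine eLpNorm_mono_enorm fun k => ?_
        simp only [enorm_eq_self, Pi.add_apply]
        refine (mul_le_mul_right (hpt k) _).trans_eq ?_
        ring
    _ ≤ _ := (eLpNorm_add_le hm1.aestronglyMeasurable hm2.aestronglyMeasurable hr).trans
        (add_le_add ?_ (weightedNorm_gainPart_le hm hr hl hf hg hh))
  exact eLpNorm_le_mul_eLpNorm_of_ae_le_mul'' _ (hb.mul hf).aestronglyMeasurable
    (Filter.Eventually.of_forall fun k => by simp)

/-! ### The Cauchy problem for a cubic vector field -/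

section CauchyProblem

open Filter Topology

/-- `f` solves `f' = C f`, `f(0) = f₀` on `[0,T]` in integral form. -/
structure IsIntegralSolution {E : Type*} [NormedAddCommGroup E] [NormedSpace ℝ E] (C : E → E)
    (T : ℝ) (f₀ : E) (f : ℝ → E) : Prop where
  continuousOn : ContinuousOn f (Icc 0 T)
  integral_eq : ∀ t ∈ Icc 0 T, f t = f₀ + ∫ s in (0 : ℝ)..t, C (f s)

/-- The local Lipschitz bound satisfied by the restriction of a trilinear map to the diagonal. -/
def IsCubicLipschitz {E : Type*} [NormedAddCommGroup E] (C : E → E) (A : ℝ) : Prop :=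
  ∀ (M : ℝ) (f g : E), ‖f‖ ≤ M → ‖g‖ ≤ M → ‖C f - C g‖ ≤ A * M ^ 2 * ‖f - g‖

/-- The guaranteed time of existence for data of norm `R`. It is at most `(8 A R²)⁻¹`, so short that
solutions stay in the ball of radius `2R` and their distances grow at most by the factor `e^{1/2}`;
the summand `1` keeps it finite for `R = 0`. -/
def existenceTime (A R : ℝ) : ℝ := (8 * A * (1 + R ^ 2))⁻¹

theorem existenceTime_pos {A : ℝ} (hA : 0 < A) (R : ℝ) : 0 < existenceTime A R := by
  unfold existenceTime; positivity

theorem mul_existenceTime_le {A : ℝ} (hA : 0 < A) (R : ℝ) :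
    8 * A * R ^ 2 * existenceTime A R ≤ 1 := by
  unfold existenceTime
  rw [mul_inv_le_iff₀ (by positivity)]
  nlinarith

theorem IsCubicLipschitz.lipschitzOnWith {E : Type*} [NormedAddCommGroup E] {C : E → E} {A : ℝ}
    (hC : IsCubicLipschitz C A) (hA : 0 ≤ A) (M : ℝ) :
    LipschitzOnWith (Real.toNNReal (A * M ^ 2)) C (Metric.closedBall 0 M) := by
  refine LipschitzOnWith.of_dist_le_mul fun f hf g hg => ?_
  rw [dist_eq_norm, dist_eq_norm, Real.coe_toNNReal _ (by positivity)]
  exact hC M f g (by simpa using hf) (by simpa using hg)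

theorem IsCubicLipschitz.continuousOn_comp {E : Type*} [NormedAddCommGroup E] {C : E → E} {A : ℝ}
    (hC : IsCubicLipschitz C A) (hA : 0 ≤ A) {T M : ℝ} {f : ℝ → E}
    (hf : ContinuousOn f (Icc 0 T)) (hM : ∀ t ∈ Icc 0 T, ‖f t‖ ≤ M) :
    ContinuousOn (fun t => C (f t)) (Icc 0 T) :=
  (hC.lipschitzOnWith hA M).continuousOn.comp hf fun t ht => by simpa using hM t ht

variable {E : Type*} [NormedAddCommGroup E] [NormedSpace ℝ E] {C : E → E} {A : ℝ}

theorem IsIntegralSolution.apply_zero {T : ℝ} {f₀ : E} {f : ℝ → E} (hT : 0 ≤ T)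
    (hf : IsIntegralSolution C T f₀ f) : f 0 = f₀ := by
  simpa using hf.integral_eq 0 ⟨le_rfl, hT⟩

theorem IsIntegralSolution.mono {T T' : ℝ} {f₀ : E} {f : ℝ → E} (hT : T' ≤ T)
    (hf : IsIntegralSolution C T f₀ f) : IsIntegralSolution C T' f₀ f :=
  ⟨hf.continuousOn.mono (Icc_subset_Icc_right hT),
    fun t ht => hf.integral_eq t (Icc_subset_Icc_right hT ht)⟩

theorem IsIntegralSolution.exists_norm_le {T : ℝ} {f₀ : E} {f : ℝ → E}
    (hf : IsIntegralSolution C T f₀ f) : ∃ M, ∀ t ∈ Icc 0 T, ‖f t‖ ≤ M :=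
  isCompact_Icc.exists_bound_of_continuousOn hf.continuousOn

theorem IsIntegralSolution.hasDerivWithinAt [CompleteSpace E] (hC : IsCubicLipschitz C A)
    (hA : 0 ≤ A) {T : ℝ} {f₀ : E} {f : ℝ → E} (hf : IsIntegralSolution C T f₀ f) {t : ℝ}
    (ht : t ∈ Ico 0 T) : HasDerivWithinAt f (C (f t)) (Ici t) t := by
  obtain ⟨M, hM⟩ := hf.exists_norm_le
  have hT : (0 : ℝ) ≤ T := ht.1.trans ht.2.le
  have hc := hC.continuousOn_comp hA hf.continuousOn hM
  -- The integrand is extended continuously, as nothing is known about `f` outside `[0,T]`.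
  set F : ℝ → E := IccExtend hT ((Icc 0 T).domRestrict fun t => C (f t)) with hF
  have hFc : Continuous F := (continuousOn_iff_continuous_domRestrict.1 hc).Icc_extend'
  have hFe : ∀ s ∈ Icc 0 T, F s = C (f s) := fun s hs => IccExtend_of_mem hT _ hs
  have hd : HasDerivAt (fun u => f₀ + ∫ s in (0 : ℝ)..u, F s) (F t) t :=
    (intervalIntegral.integral_hasDerivAt_right (hFc.intervalIntegrable _ _)
      hFc.stronglyMeasurable.stronglyMeasurableAtFilter hFc.continuousAt).const_add f₀
  rw [hFe t ⟨ht.1, ht.2.le⟩] at hd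
  have heq : ∀ u ∈ Icc 0 T, f u = f₀ + ∫ s in (0 : ℝ)..u, F s := by
    intro u hu
    rw [hf.integral_eq u hu]
    congr 1
    refine intervalIntegral.integral_congr fun s hs => ?_
    rw [uIcc_of_le hu.1] at hs
    exact (hFe s ⟨hs.1, hs.2.trans hu.2⟩).symm
  refine hd.hasDerivWithinAt.congr_of_eventuallyEq ?_ (heq t ⟨ht.1, ht.2.le⟩)
  have : Icc t T ∈ 𝓝[≥] t := Icc_mem_nhdsGE ht.2
  filter_upwards [this] with u hu
  exact heq u ⟨ht.1.trans hu.1, hu.2⟩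

/-- Stability of solutions that stay in the ball of radius `M`, by Grönwall's inequality. -/
theorem IsIntegralSolution.norm_sub_le [CompleteSpace E] (hC : IsCubicLipschitz C A)
    (hA : 0 ≤ A) {T M : ℝ} {f₀ g₀ : E} {f g : ℝ → E} (hf : IsIntegralSolution C T f₀ f)
    (hg : IsIntegralSolution C T g₀ g) (hfM : ∀ t ∈ Icc 0 T, ‖f t‖ ≤ M)
    (hgM : ∀ t ∈ Icc 0 T, ‖g t‖ ≤ M) {t : ℝ} (ht : t ∈ Icc 0 T) :
    ‖f t - g t‖ ≤ ‖f₀ - g₀‖ * Real.exp (A * M ^ 2 * t) := by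
  have hT : (0 : ℝ) ≤ T := ht.1.trans ht.2
  have := dist_le_of_trajectories_ODE_of_mem (v := fun _ => C) (s := fun _ => Metric.closedBall 0 M)
    (δ := ‖f₀ - g₀‖) (fun _ _ => hC.lipschitzOnWith hA M) hf.continuousOn
    (fun s hs => hf.hasDerivWithinAt hC hA hs)
    (fun s hs => by simpa using hfM s ⟨hs.1, hs.2.le⟩) hg.continuousOn
    (fun s hs => hg.hasDerivWithinAt hC hA hs) (fun s hs => by simpa using hgM s ⟨hs.1, hs.2.le⟩)
    (by rw [hf.apply_zero hT, hg.apply_zero hT, dist_eq_norm]) t ht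
  rwa [dist_eq_norm, sub_zero, Real.coe_toNNReal _ (by positivity)] at this

theorem IsIntegralSolution.unique [CompleteSpace E] (hC : IsCubicLipschitz C A)
    (hA : 0 ≤ A) {T : ℝ} {f₀ : E} {f g : ℝ → E} (hf : IsIntegralSolution C T f₀ f)
    (hg : IsIntegralSolution C T f₀ g) : EqOn f g (Icc 0 T) := by
  intro t ht
  obtain ⟨M, hM⟩ := hf.exists_norm_le
  obtain ⟨M', hM'⟩ := hg.exists_norm_le
  have := hf.norm_sub_le hC hA hg (M := max M M') (fun s hs => (hM s hs).trans (le_max_left _ _))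
    (fun s hs => (hM' s hs).trans (le_max_right _ _)) ht
  rw [sub_self, norm_zero, zero_mul] at this
  exact sub_eq_zero.1 (norm_le_zero_iff.1 this)

/-- The Picard-Lindelöf theorem in the ball of radius `‖f₀‖` around `f₀`. -/
theorem exists_isIntegralSolution [CompleteSpace E] (hC : IsCubicLipschitz C A) (h0 : C 0 = 0)
    (hA : 0 < A) (f₀ : E) : ∃ f : ℝ → E, IsIntegralSolution C (existenceTime A ‖f₀‖) f₀ f ∧
      ∀ t ∈ Icc 0 (existenceTime A ‖f₀‖), ‖f t‖ ≤ 2 * ‖f₀‖ := by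
  set T := existenceTime A ‖f₀‖ with hT
  have hTpos : 0 < T := existenceTime_pos hA _
  have hsub : Metric.closedBall f₀ ‖f₀‖ ⊆ Metric.closedBall 0 (2 * ‖f₀‖) := by
    intro x hx
    rw [mem_closedBall_iff_norm] at hx
    rw [mem_closedBall_zero_iff]
    have := norm_add_le (x - f₀) f₀
    rw [sub_add_cancel] at this
    linarith
  have hPL : IsPicardLindelof (fun _ => C) (tmin := 0) (tmax := T) ⟨0, le_rfl, hTpos.le⟩ f₀
      ‖f₀‖₊ 0 (Real.toNNReal (A * (2 * ‖f₀‖) ^ 2 * (2 * ‖f₀‖)))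
      (Real.toNNReal (A * (2 * ‖f₀‖) ^ 2)) := by
    refine IsPicardLindelof.of_time_independent (fun x hx => ?_)
      ((hC.lipschitzOnWith hA.le _).mono hsub) ?_
    · have hx' : ‖x‖ ≤ 2 * ‖f₀‖ := by simpa using hsub hx
      have := hC (2 * ‖f₀‖) x 0 hx' (by simp)
      rw [h0, sub_zero, sub_zero] at this
      rw [Real.coe_toNNReal _ (by positivity)]
      exact this.trans (by gcongr)
    · rw [Real.coe_toNNReal _ (by positivity)]
      simp only [sub_zero, coe_nnnorm, NNReal.coe_zero, sub_self]
      rw [max_eq_left hTpos.le]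
      have := mul_le_mul_of_nonneg_right (mul_existenceTime_le hA ‖f₀‖) (norm_nonneg f₀)
      calc _ = 8 * A * ‖f₀‖ ^ 2 * T * ‖f₀‖ := by ring
        _ ≤ _ := by simpa using this
  obtain ⟨α, hα⟩ := ODE.FunSpace.exists_isFixedPt_next hPL (x := f₀) (by simp)
  refine ⟨α.compProj, ⟨α.continuous_compProj.continuousOn, fun t ht => ?_⟩, fun t ht => ?_⟩
  · have h1 := ODE.FunSpace.next_apply hPL (x := f₀) (by simp) α (t := ⟨t, ht⟩)
    rw [hα] at h1
    rw [ODE.FunSpace.compProj_of_mem ht, h1, ODE.picard_apply]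
  · simpa using hsub (α.compProj_mem_closedBall hPL.mul_max_le)

/-- By uniqueness, every solution obeys the bound satisfied by the constructed one. -/
theorem IsIntegralSolution.norm_le [CompleteSpace E] (hC : IsCubicLipschitz C A) (h0 : C 0 = 0)
    (hA : 0 < A) {f₀ : E} {f : ℝ → E} (hf : IsIntegralSolution C (existenceTime A ‖f₀‖) f₀ f)
    {t : ℝ} (ht : t ∈ Icc 0 (existenceTime A ‖f₀‖)) : ‖f t‖ ≤ 2 * ‖f₀‖ := by
  obtain ⟨g, hg, hgn⟩ := exists_isIntegralSolution hC h0 hA f₀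
  rw [hf.unique hC hA.le hg ht]
  exact hgn t ht

/-- Continuous dependence on the data; the constant `2` exceeds `e^{1/2}`. -/
theorem IsIntegralSolution.norm_sub_le_two_mul [CompleteSpace E] (hC : IsCubicLipschitz C A)
    (h0 : C 0 = 0) (hA : 0 < A) {f₀ g₀ : E} {f g : ℝ → E}
    (hf : IsIntegralSolution C (existenceTime A ‖f₀‖) f₀ f)
    (hg : IsIntegralSolution C (existenceTime A ‖g₀‖) g₀ g) {t : ℝ}
    (ht : t ∈ Icc 0 (min (existenceTime A ‖f₀‖) (existenceTime A ‖g₀‖))) :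
    ‖f t - g t‖ ≤ 2 * ‖f₀ - g₀‖ := by
  set M := max ‖f₀‖ ‖g₀‖ with hM
  have hM0 : 0 ≤ M := (norm_nonneg f₀).trans (le_max_left _ _)
  have hmin : min (existenceTime A ‖f₀‖) (existenceTime A ‖g₀‖) ≤ existenceTime A M := by
    rcases max_choice ‖f₀‖ ‖g₀‖ with h | h
    · rw [hM, h]; exact min_le_left _ _
    · rw [hM, h]; exact min_le_right _ _
  have h1 := (hf.mono (min_le_left _ _)).norm_sub_le hC hA.le (hg.mono (min_le_right _ _))
    (M := 2 * M)
    (fun s hs => (hf.norm_le hC h0 hA (Icc_subset_Icc_right (min_le_left _ _) hs)).trans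
      (by gcongr; exact le_max_left _ _))
    (fun s hs => (hg.norm_le hC h0 hA (Icc_subset_Icc_right (min_le_right _ _) hs)).trans
      (by gcongr; exact le_max_right _ _)) ht
  have h2 : A * (2 * M) ^ 2 * t ≤ 1 / 2 := by
    have := mul_existenceTime_le hA M
    calc A * (2 * M) ^ 2 * t ≤ A * (2 * M) ^ 2 * existenceTime A M := by
          gcongr; exact ht.2.trans hmin
      _ = 8 * A * M ^ 2 * existenceTime A M / 2 := by ring
      _ ≤ 1 / 2 := by linarith
  have h3 : Real.exp (A * (2 * M) ^ 2 * t) ≤ 2 := by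
    refine (Real.exp_le_exp.2 h2).trans ?_
    rw [← Real.le_log_iff_exp_le (by norm_num)]
    linarith [Real.log_two_gt_d9]
  calc _ ≤ ‖f₀ - g₀‖ * Real.exp (A * (2 * M) ^ 2 * t) := h1
    _ ≤ ‖f₀ - g₀‖ * 2 := by gcongr
    _ = _ := mul_comm _ _

/-- Nagumo's invariance theorem: a closed set which explicit Euler steps of small size do not
leave is invariant under the flow, since the distance to it satisfies a Grönwall inequality. -/
theorem IsIntegralSolution.mem_of_euler_step_mem [CompleteSpace E] (hC : IsCubicLipschitz C A)
    (hA : 0 ≤ A) {S : Set E} (hS : IsClosed S) (h0S : (0 : E) ∈ S)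
    (hstep : ∀ M : ℝ, ∃ h₀ : ℝ, 0 < h₀ ∧ ∀ p ∈ S, ‖p‖ ≤ M → ∀ h ∈ Ioc 0 h₀, p + h • C p ∈ S)
    {T : ℝ} {f₀ : E} {f : ℝ → E} (hf : IsIntegralSolution C T f₀ f) (hf₀ : f₀ ∈ S) :
    ∀ t ∈ Icc 0 T, f t ∈ S := by
  intro t₁ ht₁
  have hT : (0 : ℝ) ≤ T := ht₁.1.trans ht₁.2
  obtain ⟨M, hM⟩ := hf.exists_norm_le
  have hM0 : 0 ≤ M := (norm_nonneg _).trans (hM 0 ⟨le_rfl, hT⟩)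
  set M' := 2 * M + 1 with hM'
  set K := A * M' ^ 2 with hK
  have hK0 : 0 ≤ K := by positivity
  have hne : S.Nonempty := ⟨0, h0S⟩
  obtain ⟨h₀, hh₀, hst⟩ := hstep M'
  set d : ℝ → ℝ := fun t => Metric.infDist (f t) S with hd
  have hdc : ContinuousOn d (Icc 0 T) :=
    (Metric.continuous_infDist_pt S).comp_continuousOn hf.continuousOn
  have hd0 : d 0 ≤ 0 := by
    rw [hd]; simp only
    rw [hf.apply_zero hT, Metric.infDist_zero_of_mem hf₀]
  have hbound := le_gronwallBound_of_liminf_deriv_right_le (f := d) (f' := fun t => K * d t)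
    (δ := 0) (K := K) (ε := 0) hdc ?_ hd0 (fun t _ => by simp) t₁ ht₁
  · rw [gronwallBound_ε0_δ0] at hbound
    have h1 : Metric.infDist (f t₁) S = 0 := le_antisymm hbound Metric.infDist_nonneg
    exact (hS.mem_iff_infDist_zero hne).2 h1
  intro t ht r hr
  have htI : t ∈ Icc 0 T := ⟨ht.1, ht.2.le⟩
  have hdt0 : 0 ≤ d t := Metric.infDist_nonneg
  set ε := (r - K * d t) / 2 with hε
  have hεpos : 0 < ε := by
    have : K * d t < r := hr
    rw [hε]; linarith
  have hder := (hf.hasDerivWithinAt hC hA ht).mono (Ioi_subset_Ici_self)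
  have hlo := (hasDerivWithinAt_iff_isLittleO.1 hder).def hεpos
  have hcont : Tendsto (fun z : ℝ => (z - t) * (1 + K * (z - t))) (𝓝[>] t) (𝓝 0) := by
    have : Continuous fun z : ℝ => (z - t) * (1 + K * (z - t)) := by fun_prop
    have h2 := (this.tendsto t).mono_left (nhdsWithin_le_nhds (s := Ioi t))
    simpa using h2
  have hsmall : ∀ᶠ z in 𝓝[>] t, (z - t) * (1 + K * (z - t)) < ε :=
    hcont.eventually (gt_mem_nhds hεpos)
  have hIoc : Ioc t (t + min 1 h₀) ∈ 𝓝[>] t :=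
    Ioc_mem_nhdsGT (by have := lt_min one_pos hh₀; linarith)
  refine Eventually.frequently ?_
  filter_upwards [hlo, hsmall, hIoc] with z hz1 hz2 hz3
  set h := z - t with hh
  have hpos : 0 < h := by rw [hh]; linarith [hz3.1]
  have hle1 : h ≤ 1 := by
    have := min_le_left 1 h₀
    rw [hh]; linarith [hz3.2]
  have hleh : h ≤ h₀ := by
    have := min_le_right 1 h₀
    rw [hh]; linarith [hz3.2]
  -- The distance from `f t` to `S` need not be attained; an error `h²` is negligible.
  obtain ⟨p, hpS, hp⟩ := (Metric.infDist_lt_iff hne (x := f t) (r := d t + h ^ 2)).1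
    (by change d t < d t + h ^ 2; have := pow_pos hpos 2; linarith)
  rw [dist_eq_norm] at hp
  have hft := hM t htI
  have hdtM : d t ≤ M := by
    refine (Metric.infDist_le_dist_of_mem h0S).trans ?_
    rw [dist_zero_right]; exact hft
  have hpM : ‖p‖ ≤ M' := by
    have h1 := _root_.norm_sub_le (f t) (f t - p)
    rw [sub_sub_cancel] at h1
    nlinarith
  have hLip := hC M' (f t) p (hft.trans (by rw [hM']; linarith)) hpM
  have hmem := hst p hpS hpM h ⟨hpos, hleh⟩
  have hdz : d z ≤ ε * h + (1 + K * h) * (d t + h ^ 2) := by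
    refine (Metric.infDist_le_dist_of_mem hmem).trans ?_
    rw [dist_eq_norm]
    have heq : f z - (p + h • C p) =
        (f z - f t - h • C (f t)) + ((f t - p) + h • (C (f t) - C p)) := by module
    have hz1' : ‖f z - f t - h • C (f t)‖ ≤ ε * h := by
      simpa [abs_of_pos hpos, Real.norm_eq_abs] using hz1
    calc _ ≤ ‖f z - f t - h • C (f t)‖ + (‖f t - p‖ + ‖h • (C (f t) - C p)‖) := by
          rw [heq]
          exact (norm_add_le _ _).trans (by gcongr; exact norm_add_le _ _)
      _ ≤ ε * h + (‖f t - p‖ + h * (K * ‖f t - p‖)) := by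
          rw [norm_smul, Real.norm_of_nonneg hpos.le]
          gcongr
      _ = ε * h + (1 + K * h) * ‖f t - p‖ := by ring
      _ ≤ _ := by gcongr
  calc h⁻¹ * (d z - d t) ≤ h⁻¹ * (ε * h + (1 + K * h) * (d t + h ^ 2) - d t) := by gcongr
    _ = ε + K * d t + h * (1 + K * h) := by field_simp; ring
    _ < ε + K * d t + ε := by linarith
    _ = r := by rw [hε]; ring

end CauchyProblem

/-! ### Embedding into a weighted `L²` space -/

/-- The weight `⟨k⟩^{-s}` lies in `L^q` if `s q > 3`, and for `q = ∞` if `s ≥ 0`. -/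
theorem memLp_bracket_rpow_neg {s : ℝ} {q : ℝ≥0∞} (hs : 0 ≤ s) (hq : q ≠ 0)
    (h : q ≠ ∞ → 3 < s * q.toReal) : MemLp (fun k : R3 => bracket k ^ (-s)) q volume := by
  have hm : AEStronglyMeasurable (fun k : R3 => bracket k ^ (-s)) volume :=
    (continuous_bracket_rpow (-s)).aestronglyMeasurable
  rcases eq_or_ne q ∞ with rfl | hqt
  · refine memLp_top_of_bound hm 1 (Filter.Eventually.of_forall fun k => ?_)
    rw [Real.norm_of_nonneg (Real.rpow_nonneg (bracket_pos k).le _)]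
    exact Real.rpow_le_one_of_one_le_of_nonpos (one_le_bracket k) (by linarith)
  · rw [← integrable_norm_rpow_iff hm hq hqt]
    have hI := integrable_rpow_neg_one_add_norm_sq (E := R3) (μ := volume) (r := s * q.toReal)
      (by simpa using h hqt)
    refine hI.congr (Filter.Eventually.of_forall fun k => ?_)
    have hk : (0 : ℝ) ≤ 1 + ‖k‖ ^ 2 := by positivity
    simp only
    rw [Real.norm_of_nonneg (Real.rpow_nonneg (bracket_pos k).le _), bracket, Real.sqrt_eq_rpow,
      ← Real.rpow_mul hk, ← Real.rpow_mul hk]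
    congr 1
    ring

theorem weightedL2_eq_eLpNorm (m : ℝ) (f : R3 → ℝ) :
    weightedL2 m (fun k => ‖f k‖ₑ) = eLpNorm (fun k => bracket k ^ m * f k) 2 volume := by
  rw [eLpNorm_eq_lintegral_rpow_enorm_toReal (by norm_num) (by norm_num), weightedL2, weightedSq]
  simp only [ENNReal.toReal_ofNat]
  congr 1
  refine lintegral_congr fun k => ?_
  rw [enorm_mul, Real.enorm_of_nonneg (Real.rpow_nonneg (bracket_pos k).le _)]
  norm_cast

theorem weightedNorm_eq_eLpNorm (l : ℝ) (r : ℝ≥0∞) (f : R3 → ℝ) :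
    weightedNorm l r (fun k => ‖f k‖ₑ) = eLpNorm (fun k => bracket k ^ l * f k) r volume := by
  unfold weightedNorm
  refine eLpNorm_congr_enorm_ae (Filter.Eventually.of_forall fun k => ?_)
  simp only
  rw [enorm_mul, Real.enorm_of_nonneg (Real.rpow_nonneg (bracket_pos k).le _), enorm_eq_self]

/-- By Hölder's inequality, `⟨k⟩^{-l} L^r` embeds into `⟨k⟩^{-m} L²` with `m = 1/2 + δ/2`: the
weight `⟨k⟩^{m-l}` lies in `L^q` for `1/q = 1/2 - 1/r`, since `l - m = 3/q + δ/2`. -/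
theorem exists_weightedL2_le {r : ℝ≥0∞} (hr : 2 ≤ r) {δ : ℝ} (hδ : 0 < δ) :
    ∃ B : ℝ≥0∞, B ≠ ∞ ∧ ∀ f : R3 → ℝ, Measurable f →
      weightedL2 (1 / 2 + δ / 2) (fun k => ‖f k‖ₑ) ≤
        B * weightedNorm (weightExponent r δ) r (fun k => ‖f k‖ₑ) := by
  set m := 1 / 2 + δ / 2 with hm
  set l := weightExponent r δ with hl
  set q : ℝ≥0∞ := (2⁻¹ - r⁻¹)⁻¹ with hq
  have hinv : r⁻¹ ≤ 2⁻¹ := ENNReal.inv_le_inv.2 hr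
  have hri : r⁻¹ ≠ ∞ := ne_top_of_le_ne_top (by norm_num) hinv
  have hqi : q⁻¹.toReal = 1 / 2 - (r⁻¹).toReal := by
    rw [hq, inv_inv, ENNReal.toReal_sub_of_le hinv (by norm_num)]
    norm_num
  have hH : ENNReal.HolderTriple q r 2 := ⟨by rw [hq, inv_inv, tsub_add_cancel_of_le hinv]⟩
  have hs : l - m = 3 * q⁻¹.toReal + δ / 2 := by
    rw [hqi, hl, hm, weightExponent]; ring
  have hq0 : q ≠ 0 := by
    rw [hq, ENNReal.inv_ne_zero]
    exact ne_top_of_le_ne_top (by norm_num) tsub_le_self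
  have hw : MemLp (fun k : R3 => bracket k ^ (-(l - m))) q volume := by
    refine memLp_bracket_rpow_neg ?_ hq0 fun hqt => ?_
    · rw [hs]
      have : 0 ≤ q⁻¹.toReal := ENNReal.toReal_nonneg
      linarith
    · have hqp : 0 < q.toReal := ENNReal.toReal_pos hq0 hqt
      rw [hs, ENNReal.toReal_inv]
      have : (3 * q.toReal⁻¹ + δ / 2) * q.toReal = 3 + δ / 2 * q.toReal := by field_simp
      rw [this]
      have := mul_pos (half_pos hδ) hqp
      linarith
  refine ⟨_, hw.eLpNorm_ne_top, fun f hf => ?_⟩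
  rw [weightedL2_eq_eLpNorm, weightedNorm_eq_eLpNorm]
  have hfm : AEStronglyMeasurable (fun k => bracket k ^ l * f k) volume :=
    ((measurable_bracket_rpow l).mul hf).aestronglyMeasurable
  refine le_trans (le_of_eq ?_) (eLpNorm_smul_le_mul_eLpNorm (p := q) (q := r) (r := 2) hfm hw.1)
  congr 1
  funext k
  rw [Pi.smul_apply', smul_eq_mul, ← mul_assoc, ← Real.rpow_add (bracket_pos k)]
  congr 2
  ring

/-! ### The collision operator as a trilinear map -/

/-- The integrand of the trilinear form of the collision operator, a trilinear function of
`(f, g, h)` which for `f = g = h` becomes the integrand of the collision operator. -/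
def trilinearIntegrand (f g h : R3 → ℝ) (k : R3) (p : R3 × S2) : ℝ :=
  ‖k - p.1‖ * (g (kStar k p.1 p.2) * h (kOneStar k p.1 p.2) * (f k + f p.1) -
    f k * g p.1 * (h (kStar k p.1 p.2) + h (kOneStar k p.1 p.2)))

/-- The trilinear form of the collision operator. -/
def trilinearCollision (f g h : R3 → ℝ) (k : R3) : ℝ :=
  1 / 8 * ∫ p, trilinearIntegrand f g h k p ∂resonantMeasure

theorem measurable_trilinearIntegrand {f g h : R3 → ℝ} (hf : Measurable f) (hg : Measurable g)
    (hh : Measurable h) :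
    Measurable fun q : R3 × (R3 × S2) => trilinearIntegrand f g h q.1 q.2 := by
  unfold trilinearIntegrand; fun_prop

theorem measurable_trilinearCollision {f g h : R3 → ℝ} (hf : Measurable f) (hg : Measurable g)
    (hh : Measurable h) : Measurable (trilinearCollision f g h) :=
  (measurable_trilinearIntegrand hf hg hh).stronglyMeasurable.integral_prod_right'.measurable.const_mul
    (1 / 8)

theorem lintegral_trilinearIntegrand_le (f g h : R3 → ℝ) (k : R3) :
    ∫⁻ p, ‖trilinearIntegrand f g h k p‖ₑ ∂resonantMeasure ≤
      collisionBound (fun k => ‖f k‖ₑ) (fun k => ‖g k‖ₑ) (fun k => ‖h k‖ₑ) k := by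
  refine lintegral_mono fun p => ?_
  rw [trilinearIntegrand, enorm_mul, Real.enorm_of_nonneg (norm_nonneg _)]
  refine mul_le_mul_right ?_ _
  refine enorm_sub_le.trans ?_
  rw [enorm_mul, enorm_mul, enorm_mul, enorm_mul]
  gcongr <;> exact enorm_add_le _ _

theorem enorm_trilinearCollision_le (f g h : R3 → ℝ) (k : R3) :
    ‖trilinearCollision f g h k‖ₑ ≤
      collisionBound (fun k => ‖f k‖ₑ) (fun k => ‖g k‖ₑ) (fun k => ‖h k‖ₑ) k := by
  rw [trilinearCollision, enorm_mul]
  have h8 : ‖(1 / 8 : ℝ)‖ₑ ≤ 1 := by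
    rw [Real.enorm_of_nonneg (by norm_num), ENNReal.ofReal_le_one]; norm_num
  calc _ ≤ 1 * ∫⁻ p, ‖trilinearIntegrand f g h k p‖ₑ ∂resonantMeasure :=
        mul_le_mul' h8 (enorm_integral_le_lintegral_enorm _)
    _ ≤ _ := by rw [one_mul]; exact lintegral_trilinearIntegrand_le f g h k

/-- Null sets of wave numbers do not matter: almost every resonant quadruple avoids them. -/
theorem ae_resonant_of_ae {P : R3 → Prop} (hP : ∀ᵐ x, P x) :
    ∀ᵐ k : R3, ∀ᵐ p ∂resonantMeasure,
      P p.1 ∧ P (kStar k p.1 p.2) ∧ P (kOneStar k p.1 p.2) := by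
  set N := toMeasurable volume {x | ¬ P x} with hN
  have hNm : MeasurableSet N := measurableSet_toMeasurable _ _
  have hN0 : volume N = 0 := by rw [hN, measure_toMeasurable]; exact hP
  have hPN : ∀ x, x ∉ N → P x := fun x hx => by
    by_contra hcon
    exact hx (subset_toMeasurable _ _ hcon)
  have h1 : ∀ᵐ p ∂resonantMeasure, P p.1 := Measure.quasiMeasurePreserving_fst.ae hP
  have hI : Measurable (N.indicator fun _ => (1 : ℝ≥0∞)) := measurable_const.indicator hNm
  have hswap := lintegral_collision_swap (Φ := fun x => N.indicator (fun _ => (1 : ℝ≥0∞)) x.2.2.2)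
    (by fun_prop)
  have hzero : ∫⁻ k : R3, (∫⁻ _ : R3 × S2, N.indicator (fun _ => (1 : ℝ≥0∞)) k
      ∂resonantMeasure) = 0 := by
    rw [lintegral_eq_zero_iff (by simp only [lintegral_const]; exact hI.mul_const _)]
    filter_upwards [compl_mem_ae_iff.2 hN0] with k hk
    rw [indicator_of_notMem hk]
    simp
  simp only at hswap
  rw [hzero] at hswap
  have hm : Measurable fun q : R3 × (R3 × S2) =>
      N.indicator (fun _ => (1 : ℝ≥0∞)) (kOneStar q.1 q.2.1 q.2.2) := by fun_prop
  rw [lintegral_eq_zero_iff hm.lintegral_prod_right'] at hswap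
  filter_upwards [hswap] with k hk
  have hk : ∫⁻ p, N.indicator (fun _ => (1 : ℝ≥0∞)) (kOneStar k p.1 p.2) ∂resonantMeasure = 0 := hk
  rw [lintegral_eq_zero_iff (by fun_prop)] at hk
  have h3 : ∀ᵐ p ∂resonantMeasure, P (kOneStar k p.1 p.2) := by
    filter_upwards [hk] with p hp
    refine hPN _ fun hmem => ?_
    rw [indicator_of_mem hmem] at hp
    exact one_ne_zero hp
  have h2 : ∀ᵐ p ∂resonantMeasure, P (kStar k p.1 p.2) := by
    have := ((MeasurePreserving.id volume).prod
      measurePreserving_neg_surf).quasiMeasurePreserving.ae h3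
    filter_upwards [this] with p hp
    have h4 : kOneStar k p.1 (-p.2) = kStar k p.1 p.2 := by rw [← kStar_neg, neg_neg]
    rw [← h4]; exact hp
  filter_upwards [h1, h2, h3] with p a b c using ⟨a, b, c⟩

theorem trilinearCollision_congr {f g h f' g' h' : R3 → ℝ} (hf : f =ᵐ[volume] f')
    (hg : g =ᵐ[volume] g') (hh : h =ᵐ[volume] h') :
    trilinearCollision f g h =ᵐ[volume] trilinearCollision f' g' h' := by
  filter_upwards [hf, ae_resonant_of_ae hf, ae_resonant_of_ae hg, ae_resonant_of_ae hh]
    with k h0 h1 h2 h3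
  unfold trilinearCollision
  congr 1
  refine integral_congr_ae ?_
  filter_upwards [h1, h2, h3] with p a b c
  simp only [trilinearIntegrand, h0, a, b, c]

namespace WeightedLp

variable {l : ℝ} {r : ℝ≥0∞}

theorem measurable (f : WeightedLp l r) : Measurable f :=
  (AEEqFun.stronglyMeasurable (Subtype.val f)).measurable

theorem coe_sub_ae (f g : WeightedLp l r) : (f - g : WeightedLp l r) =ᵐ[volume] fun k => f k - g k :=
  AEEqFun.coeFn_sub (Subtype.val f) (Subtype.val g)

theorem coe_add_ae (f g : WeightedLp l r) : (f + g : WeightedLp l r) =ᵐ[volume] fun k => f k + g k :=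
  AEEqFun.coeFn_add (Subtype.val f) (Subtype.val g)

theorem coe_smul_ae (c : ℝ) (f : WeightedLp l r) :
    (c • f : WeightedLp l r) =ᵐ[volume] fun k => c * f k :=
  AEEqFun.coeFn_smul c (Subtype.val f)

theorem ext_ae {f g : WeightedLp l r} (h : f =ᵐ[volume] g) : f = g :=
  Subtype.ext (AEEqFun.ext h)

theorem weightedNorm_eq [Fact (1 ≤ r)] (f : WeightedLp l r) :
    weightedNorm l r (fun k => ‖f k‖ₑ) = ENNReal.ofReal ‖f‖ := by
  have h : MemLp (fun k => bracket k ^ l * f k) r volume := f.2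
  rw [weightedNorm_eq_eLpNorm, norm_eq, ENNReal.ofReal_toReal h.eLpNorm_ne_top]

/-- The element of `⟨k⟩^{-l} L^r` represented by a measurable function of finite norm. -/
def mk (F : R3 → ℝ) (hF : Measurable F) (h : weightedNorm l r (fun k => ‖F k‖ₑ) ≠ ∞) :
    WeightedLp l r :=
  ⟨AEEqFun.mk F hF.aestronglyMeasurable, by
    have hm : AEStronglyMeasurable F (volume : Measure R3) := hF.aestronglyMeasurable
    have hae : (fun k => bracket k ^ l * AEEqFun.mk F hm k) =ᵐ[volume]
        fun k => bracket k ^ l * F k := by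
      filter_upwards [AEEqFun.coeFn_mk F hm] with k hk
      rw [hk]
    refine (memLp_congr_ae hae).2 ⟨((measurable_bracket_rpow l).mul hF).aestronglyMeasurable, ?_⟩
    rw [← weightedNorm_eq_eLpNorm]
    exact h.lt_top⟩

theorem coe_mk_ae (F : R3 → ℝ) (hF : Measurable F)
    (h : weightedNorm l r (fun k => ‖F k‖ₑ) ≠ ∞) : (mk F hF h : R3 → ℝ) =ᵐ[volume] F :=
  AEEqFun.coeFn_mk F hF.aestronglyMeasurable

theorem norm_mk [Fact (1 ≤ r)] (F : R3 → ℝ) (hF : Measurable F)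
    (h : weightedNorm l r (fun k => ‖F k‖ₑ) ≠ ∞) :
    ENNReal.ofReal ‖mk F hF h‖ = weightedNorm l r (fun k => ‖F k‖ₑ) := by
  rw [← weightedNorm_eq]
  refine eLpNorm_congr_ae ?_
  filter_upwards [coe_mk_ae F hF h] with k hk
  rw [hk]

/-- Under the isometry `weight`, this set is the positive cone of `L^r`. -/
theorem isClosed_nonneg [Fact (1 ≤ r)] :
    IsClosed {f : WeightedLp l r | ∀ᵐ k : R3, 0 ≤ f k} := by
  have hi : Isometry (weight (l := l) (r := r)) :=
    AddMonoidHomClass.isometry_of_norm weight fun _ => rfl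
  have hset : {f : WeightedLp l r | ∀ᵐ k : R3, 0 ≤ f k} =
      weight (l := l) (r := r) ⁻¹' {F : Lp ℝ r (volume : Measure R3) | 0 ≤ F} := by
    ext f
    simp only [mem_ofPred_eq, mem_preimage]
    rw [← Lp.coeFn_nonneg]
    constructor
    · intro h
      filter_upwards [h, weight_coe_ae f] with k hk hw
      rw [hw]
      exact mul_nonneg (Real.rpow_nonneg (bracket_pos k).le l) hk
    · intro h
      filter_upwards [h, weight_coe_ae f] with k hk hw
      rw [hw] at hk
      exact nonneg_of_mul_nonneg_right hk (Real.rpow_pos_of_pos (bracket_pos k) l)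
  rw [hset]
  exact isClosed_Ici.preimage hi.continuous

end WeightedLp

/-- The estimates on which the theory in `⟨k⟩^{-l} L^r` rests: an embedding into `⟨k⟩^{-m} L²`
for some `m > 1/2`, with norm at most `B`. -/
structure IsAdmissible (l : ℝ) (r : ℝ≥0∞) (m : ℝ) (B : ℝ≥0∞) : Prop where
  one_le : 1 ≤ r
  nonneg : 0 ≤ l
  half_lt : 1 / 2 < m
  ne_top : B ≠ ∞
  weightedL2_le : ∀ f : R3 → ℝ, Measurable f →
    weightedL2 m (fun k => ‖f k‖ₑ) ≤ B * weightedNorm l r (fun k => ‖f k‖ₑ)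

/-- The constant in the trilinear estimate. -/
def collisionConst (l m : ℝ) (B : ℝ≥0∞) : ℝ≥0∞ :=
  (3 + 2 * ENNReal.ofReal (2 ^ l)) * frequencyConst m * B ^ 2

namespace IsAdmissible

variable {l : ℝ} {r : ℝ≥0∞} {m : ℝ} {B : ℝ≥0∞}

theorem collisionConst_ne_top (H : IsAdmissible l r m B) : collisionConst l m B ≠ ∞ := by
  have := H.ne_top
  have := frequencyConst_ne_top H.half_lt
  unfold collisionConst
  finiteness

theorem weightedNorm_le (H : IsAdmissible l r m B) {f g h : R3 → ℝ} (hf : Measurable f)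
    (hg : Measurable g) (hh : Measurable h) :
    weightedNorm l r (collisionBound (fun k => ‖f k‖ₑ) (fun k => ‖g k‖ₑ) (fun k => ‖h k‖ₑ)) ≤
      collisionConst l m B * (weightedNorm l r (fun k => ‖f k‖ₑ) *
        weightedNorm l r (fun k => ‖g k‖ₑ) * weightedNorm l r (fun k => ‖h k‖ₑ)) := by
  refine (weightedNorm_collisionBound_le H.half_lt H.one_le H.nonneg hf.enorm hg.enorm
    hh.enorm).trans ?_
  have h1 := H.weightedL2_le f hf
  have h2 := H.weightedL2_le g hg
  have h3 := H.weightedL2_le h hh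
  set x := weightedNorm l r (fun k => ‖f k‖ₑ)
  set y := weightedNorm l r (fun k => ‖g k‖ₑ)
  set z := weightedNorm l r (fun k => ‖h k‖ₑ)
  calc _ ≤ 3 * frequencyConst m * ((B * y) * (B * z)) * x + ENNReal.ofReal (2 ^ l) *
        frequencyConst m * ((B * x) * (B * z) * y + (B * x) * (B * y) * z) := by gcongr
    _ = _ := by unfold collisionConst; ring

theorem weightedNorm_trilinear_le (H : IsAdmissible l r m B) {f g h : R3 → ℝ} (hf : Measurable f)
    (hg : Measurable g) (hh : Measurable h) :
    weightedNorm l r (fun k => ‖trilinearCollision f g h k‖ₑ) ≤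
      collisionConst l m B * (weightedNorm l r (fun k => ‖f k‖ₑ) *
        weightedNorm l r (fun k => ‖g k‖ₑ) * weightedNorm l r (fun k => ‖h k‖ₑ)) := by
  refine le_trans (eLpNorm_mono_enorm fun k => ?_) (H.weightedNorm_le hf hg hh)
  simp only [enorm_eq_self]
  exact mul_le_mul_right (enorm_trilinearCollision_le f g h k) _

theorem product_ne_top [Fact (1 ≤ r)] (H : IsAdmissible l r m B) (f g h : WeightedLp l r) :
    collisionConst l m B * (weightedNorm l r (fun k => ‖f k‖ₑ) *
        weightedNorm l r (fun k => ‖g k‖ₑ) * weightedNorm l r (fun k => ‖h k‖ₑ)) ≠ ∞ := by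
  have := H.collisionConst_ne_top
  simp only [WeightedLp.weightedNorm_eq]
  finiteness

theorem ae_collisionBound_lt_top [Fact (1 ≤ r)] (H : IsAdmissible l r m B)
    (f g h : WeightedLp l r) :
    ∀ᵐ k : R3, collisionBound (fun k => ‖f k‖ₑ) (fun k => ‖g k‖ₑ) (fun k => ‖h k‖ₑ) k < ∞ := by
  have hle := H.weightedNorm_le f.measurable g.measurable h.measurable
  have hfin := (hle.trans_lt (H.product_ne_top f g h).lt_top).ne
  have hf := f.measurable
  have hg := g.measurable
  have hh := h.measurable
  have hmeas : Measurable (collisionBound (fun k => ‖f k‖ₑ) (fun k => ‖g k‖ₑ) (fun k => ‖h k‖ₑ)) := by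
    unfold collisionBound
    exact Measurable.lintegral_prod_right' (f := fun q : R3 × (R3 × S2) =>
      ENNReal.ofReal ‖q.1 - q.2.1‖ * (‖g (kStar q.1 q.2.1 q.2.2)‖ₑ *
        ‖h (kOneStar q.1 q.2.1 q.2.2)‖ₑ * (‖f q.1‖ₑ + ‖f q.2.1‖ₑ) +
      ‖f q.1‖ₑ * ‖g q.2.1‖ₑ * (‖h (kStar q.1 q.2.1 q.2.2)‖ₑ + ‖h (kOneStar q.1 q.2.1 q.2.2)‖ₑ)))
      (by fun_prop)
  have hw : Measurable fun k => ENNReal.ofReal (bracket k ^ l) *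
      collisionBound (fun k => ‖f k‖ₑ) (fun k => ‖g k‖ₑ) (fun k => ‖h k‖ₑ) k :=
    (measurable_bracket_rpow l).ennreal_ofReal.mul hmeas
  have hae : ∀ᵐ k : R3, ENNReal.ofReal (bracket k ^ l) *
      collisionBound (fun k => ‖f k‖ₑ) (fun k => ‖g k‖ₑ) (fun k => ‖h k‖ₑ) k < ∞ := by
    have hr0 : r ≠ 0 := (zero_lt_one.trans_le H.one_le).ne'
    rcases eq_or_ne r ∞ with hr | hr
    · subst hr
      rw [weightedNorm, eLpNorm_exponent_top] at hfin
      filter_upwards [enorm_ae_le_eLpNormEssSup (fun k => ENNReal.ofReal (bracket k ^ l) *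
        collisionBound (fun k => ‖f k‖ₑ) (fun k => ‖g k‖ₑ) (fun k => ‖h k‖ₑ) k) volume] with k hk
      rw [enorm_eq_self] at hk
      exact hk.trans_lt hfin.lt_top
    · rw [weightedNorm, eLpNorm_eq_lintegral_rpow_enorm_toReal hr0 hr] at hfin
      have hrp : 0 < r.toReal := ENNReal.toReal_pos hr0 hr
      have h2 : ∫⁻ k, (ENNReal.ofReal (bracket k ^ l) * collisionBound (fun k => ‖f k‖ₑ)
          (fun k => ‖g k‖ₑ) (fun k => ‖h k‖ₑ) k) ^ r.toReal ≠ ∞ := by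
        intro htop
        simp only [enorm_eq_self] at hfin
        rw [htop, ENNReal.top_rpow_of_pos (by positivity)] at hfin
        exact hfin rfl
      filter_upwards [ae_lt_top (hw.pow_const _) h2] with k hk
      exact (ENNReal.rpow_lt_top_iff_of_pos hrp).1 hk
  filter_upwards [hae] with k hk
  by_contra hcon
  rw [not_lt, top_le_iff] at hcon
  rw [hcon, ENNReal.mul_top] at hk
  · exact lt_irrefl _ hk
  · exact (ENNReal.ofReal_pos.2 (Real.rpow_pos_of_pos (bracket_pos k) l)).ne'

theorem ae_integrable_trilinear [Fact (1 ≤ r)] (H : IsAdmissible l r m B)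
    (f g h : WeightedLp l r) :
    ∀ᵐ k : R3, Integrable (trilinearIntegrand f g h k) resonantMeasure := by
  filter_upwards [H.ae_collisionBound_lt_top f g h] with k hk
  refine ⟨((measurable_trilinearIntegrand f.measurable g.measurable h.measurable).comp
    measurable_prodMk_left).aestronglyMeasurable, ?_⟩
  exact (lintegral_trilinearIntegrand_le f g h k).trans_lt hk

theorem lintegral_frequency_integrand_le [Fact (1 ≤ r)] (H : IsAdmissible l r m B)
    (f : WeightedLp l r) (k : R3) :
    ∫⁻ p, ‖resonantIntegrand (frequencyDensity f) k p‖ₑ ∂resonantMeasure ≤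
      2 * frequencyConst m * B ^ 2 * ENNReal.ofReal ‖f‖ ^ 2 := by
  have hf := f.measurable
  have h1 := lintegral_frequency_le H.half_lt hf.enorm hf.enorm k
  have h2 := lintegral_frequency_le' H.half_lt hf.enorm hf.enorm k
  have h3 := H.weightedL2_le f hf
  rw [f.weightedNorm_eq] at h3
  have hC : frequencyConst m * (weightedSq m (fun k => ‖f k‖ₑ) ^ (1 / 2 : ℝ) *
      weightedSq m (fun k => ‖f k‖ₑ) ^ (1 / 2 : ℝ)) ≤
      frequencyConst m * ((B * ENNReal.ofReal ‖f‖) * (B * ENNReal.ofReal ‖f‖)) := by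
    unfold weightedL2 at h3
    gcongr
  calc _ ≤ ∫⁻ p, (ENNReal.ofReal ‖k - p.1‖ * (‖f p.1‖ₑ * ‖f (kStar k p.1 p.2)‖ₑ) +
        ENNReal.ofReal ‖k - p.1‖ * (‖f p.1‖ₑ * ‖f (kOneStar k p.1 p.2)‖ₑ)) ∂resonantMeasure := by
        refine lintegral_mono fun p => ?_
        rw [resonantIntegrand, frequencyDensity, enorm_mul, enorm_mul,
          Real.enorm_of_nonneg (norm_nonneg _), ← mul_add, ← mul_add]
        gcongr
        exact enorm_add_le _ _
    _ ≤ _ := by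
        rw [lintegral_add_left (by fun_prop)]
        refine (add_le_add (h1.trans hC) (h2.trans hC)).trans_eq ?_
        ring

theorem frequencyBound_ne_top (H : IsAdmissible l r m B) : 2 * frequencyConst m * B ^ 2 ≠ ∞ := by
  have := H.ne_top
  have := frequencyConst_ne_top H.half_lt
  finiteness

theorem integrable_frequency [Fact (1 ≤ r)] (H : IsAdmissible l r m B) (f : WeightedLp l r)
    (k : R3) : Integrable (resonantIntegrand (frequencyDensity f) k) resonantMeasure := by
  have hf := f.measurable
  refine ⟨?_, (H.lintegral_frequency_integrand_le f k).trans_lt ?_⟩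
  · have : Measurable (resonantIntegrand (frequencyDensity f) k) := by
      unfold resonantIntegrand frequencyDensity; fun_prop
    exact this.aestronglyMeasurable
  · have := H.frequencyBound_ne_top
    finiteness

/-- The collision frequency is a bounded function. -/
theorem collisionFrequency_le [Fact (1 ≤ r)] (H : IsAdmissible l r m B) (f : WeightedLp l r)
    (k : R3) : collisionFrequency f k ≤ (2 * frequencyConst m * B ^ 2).toReal * ‖f‖ ^ 2 := by
  have h1 : ‖∫ p, resonantIntegrand (frequencyDensity f) k p ∂resonantMeasure‖ ≤
      (2 * frequencyConst m * B ^ 2).toReal * ‖f‖ ^ 2 := by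
    rw [← ENNReal.ofReal_le_ofReal_iff (by positivity), ofReal_norm,
      ENNReal.ofReal_mul ENNReal.toReal_nonneg, ENNReal.ofReal_toReal H.frequencyBound_ne_top,
      ENNReal.ofReal_pow (norm_nonneg _)]
    exact (enorm_integral_le_lintegral_enorm _).trans (H.lintegral_frequency_integrand_le f k)
  have h2 := (Real.le_norm_self _).trans h1
  have h3 : 0 ≤ (2 * frequencyConst m * B ^ 2).toReal * ‖f‖ ^ 2 := by positivity
  rw [collisionFrequency, resonantIntegral]
  linarith

theorem collisionConverges [Fact (1 ≤ r)] (H : IsAdmissible l r m B) (f : WeightedLp l r) :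
    CollisionConverges f := by
  have hf := f.measurable
  filter_upwards [H.ae_collisionBound_lt_top f f f] with k hk
  refine ⟨⟨?_, lt_of_le_of_lt (lintegral_mono fun p => ?_) hk⟩, H.integrable_frequency f k⟩
  · have : Measurable (resonantIntegrand (gainDensity f) k) := by
      unfold resonantIntegrand gainDensity; fun_prop
    exact this.aestronglyMeasurable
  · rw [resonantIntegrand, gainDensity, enorm_mul, Real.enorm_of_nonneg (norm_nonneg _)]
    refine mul_le_mul_right (le_trans ?_ le_self_add) _
    rw [enorm_mul, enorm_mul]
    gcongr
    exact enorm_add_le _ _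

theorem trilinearCollision_diag [Fact (1 ≤ r)] (H : IsAdmissible l r m B) (f : WeightedLp l r) :
    trilinearCollision f f f =ᵐ[volume] collision f := by
  filter_upwards [H.collisionConverges f] with k hk
  rw [collision, gain, collisionFrequency, resonantIntegral, resonantIntegral, mul_left_comm,
    ← mul_sub, ← integral_const_mul, ← integral_sub hk.1 (hk.2.const_mul _), trilinearCollision]
  congr 2
  funext p
  simp only [trilinearIntegrand, resonantIntegrand, gainDensity, frequencyDensity]
  ring

/-- The trilinear form of the collision operator on `⟨k⟩^{-l} L^r`. -/
def trilinear [Fact (1 ≤ r)] (H : IsAdmissible l r m B) (f g h : WeightedLp l r) :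
    WeightedLp l r :=
  WeightedLp.mk (trilinearCollision f g h)
    (measurable_trilinearCollision f.measurable g.measurable h.measurable)
    ((H.weightedNorm_trilinear_le f.measurable g.measurable h.measurable).trans_lt
      (H.product_ne_top f g h).lt_top).ne

theorem trilinear_ae [Fact (1 ≤ r)] (H : IsAdmissible l r m B) (f g h : WeightedLp l r) :
    H.trilinear f g h =ᵐ[volume] trilinearCollision f g h :=
  WeightedLp.coe_mk_ae _ _ _

theorem norm_trilinear_le [Fact (1 ≤ r)] (H : IsAdmissible l r m B) (f g h : WeightedLp l r) :
    ‖H.trilinear f g h‖ ≤ (collisionConst l m B).toReal * (‖f‖ * ‖g‖ * ‖h‖) := by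
  have h1 := H.weightedNorm_trilinear_le f.measurable g.measurable h.measurable
  rw [← ENNReal.ofReal_le_ofReal_iff (by positivity), trilinear, WeightedLp.norm_mk,
    ENNReal.ofReal_mul ENNReal.toReal_nonneg, ENNReal.ofReal_toReal H.collisionConst_ne_top,
    ENNReal.ofReal_mul (by positivity), ENNReal.ofReal_mul (by positivity)]
  simpa only [WeightedLp.weightedNorm_eq] using h1

theorem trilinear_sub_left [Fact (1 ≤ r)] (H : IsAdmissible l r m B) (f f' g h : WeightedLp l r) :
    H.trilinear (f - f') g h = H.trilinear f g h - H.trilinear f' g h := by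
  refine WeightedLp.ext_ae ?_
  filter_upwards [H.trilinear_ae (f - f') g h, H.trilinear_ae f g h, H.trilinear_ae f' g h,
    WeightedLp.coe_sub_ae (H.trilinear f g h) (H.trilinear f' g h),
    trilinearCollision_congr (WeightedLp.coe_sub_ae f f') (ae_eq_refl g) (ae_eq_refl h),
    H.ae_integrable_trilinear f g h, H.ae_integrable_trilinear f' g h] with k e1 e2 e3 e4 e5 i1 i2
  rw [e1, e4, e2, e3, e5, trilinearCollision, trilinearCollision, trilinearCollision, ← mul_sub,
    ← integral_sub i1 i2]
  congr 2
  funext p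
  simp only [trilinearIntegrand]
  ring

theorem trilinear_sub_middle [Fact (1 ≤ r)] (H : IsAdmissible l r m B)
    (f g g' h : WeightedLp l r) :
    H.trilinear f (g - g') h = H.trilinear f g h - H.trilinear f g' h := by
  refine WeightedLp.ext_ae ?_
  filter_upwards [H.trilinear_ae f (g - g') h, H.trilinear_ae f g h, H.trilinear_ae f g' h,
    WeightedLp.coe_sub_ae (H.trilinear f g h) (H.trilinear f g' h),
    trilinearCollision_congr (ae_eq_refl f) (WeightedLp.coe_sub_ae g g') (ae_eq_refl h),
    H.ae_integrable_trilinear f g h, H.ae_integrable_trilinear f g' h] with k e1 e2 e3 e4 e5 i1 i2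
  rw [e1, e4, e2, e3, e5, trilinearCollision, trilinearCollision, trilinearCollision, ← mul_sub,
    ← integral_sub i1 i2]
  congr 2
  funext p
  simp only [trilinearIntegrand]
  ring

theorem trilinear_sub_right [Fact (1 ≤ r)] (H : IsAdmissible l r m B) (f g h h' : WeightedLp l r) :
    H.trilinear f g (h - h') = H.trilinear f g h - H.trilinear f g h' := by
  refine WeightedLp.ext_ae ?_
  filter_upwards [H.trilinear_ae f g (h - h'), H.trilinear_ae f g h, H.trilinear_ae f g h',
    WeightedLp.coe_sub_ae (H.trilinear f g h) (H.trilinear f g h'),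
    trilinearCollision_congr (ae_eq_refl f) (ae_eq_refl g) (WeightedLp.coe_sub_ae h h'),
    H.ae_integrable_trilinear f g h, H.ae_integrable_trilinear f g h'] with k e1 e2 e3 e4 e5 i1 i2
  rw [e1, e4, e2, e3, e5, trilinearCollision, trilinearCollision, trilinearCollision, ← mul_sub,
    ← integral_sub i1 i2]
  congr 2
  funext p
  simp only [trilinearIntegrand]
  ring

/-- The collision operator as a vector field on `⟨k⟩^{-l} L^r`. -/
def collisionField [Fact (1 ≤ r)] (H : IsAdmissible l r m B) (f : WeightedLp l r) :
    WeightedLp l r :=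
  H.trilinear f f f

theorem collisionField_ae [Fact (1 ≤ r)] (H : IsAdmissible l r m B) (f : WeightedLp l r) :
    H.collisionField f =ᵐ[volume] collision f :=
  (H.trilinear_ae f f f).trans (H.trilinearCollision_diag f)

theorem collisionField_zero [Fact (1 ≤ r)] (H : IsAdmissible l r m B) :
    H.collisionField (0 : WeightedLp l r) = 0 := by
  have := H.norm_trilinear_le 0 0 0
  rw [norm_zero, mul_zero, mul_zero] at this
  exact norm_le_zero_iff.1 this

/-- The constant in the Lipschitz estimate; adding `1` makes it positive. -/
def lipschitzConst (l m : ℝ) (B : ℝ≥0∞) : ℝ := 3 * (collisionConst l m B).toReal + 1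

theorem lipschitzConst_pos (l m : ℝ) (B : ℝ≥0∞) : 0 < lipschitzConst l m B := by
  unfold lipschitzConst; positivity

theorem isCubicLipschitz [Fact (1 ≤ r)] (H : IsAdmissible l r m B) :
    IsCubicLipschitz (H.collisionField : WeightedLp l r → WeightedLp l r)
      (lipschitzConst l m B) := by
  intro M f g hf hg
  have hM : 0 ≤ M := (norm_nonneg f).trans hf
  have heq : H.collisionField f - H.collisionField g = H.trilinear (f - g) f f +
      (H.trilinear g (f - g) f + H.trilinear g g (f - g)) := by
    rw [H.trilinear_sub_left, H.trilinear_sub_middle, H.trilinear_sub_right, collisionField,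
      collisionField]
    abel
  set c := (collisionConst l m B).toReal with hc
  have hc0 : 0 ≤ c := ENNReal.toReal_nonneg
  calc ‖H.collisionField f - H.collisionField g‖
      ≤ ‖H.trilinear (f - g) f f‖ + (‖H.trilinear g (f - g) f‖ + ‖H.trilinear g g (f - g)‖) := by
        rw [heq]
        exact (norm_add_le _ _).trans (by gcongr; exact norm_add_le _ _)
    _ ≤ c * (‖f - g‖ * ‖f‖ * ‖f‖) + (c * (‖g‖ * ‖f - g‖ * ‖f‖) + c * (‖g‖ * ‖g‖ * ‖f - g‖)) := by
        gcongr <;> exact H.norm_trilinear_le _ _ _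
    _ ≤ c * (‖f - g‖ * M * M) + (c * (M * ‖f - g‖ * M) + c * (M * M * ‖f - g‖)) := by gcongr
    _ = 3 * c * (M ^ 2 * ‖f - g‖) := by ring
    _ ≤ lipschitzConst l m B * M ^ 2 * ‖f - g‖ := by
        have hnn : 0 ≤ M ^ 2 * ‖f - g‖ := by positivity
        rw [lipschitzConst, mul_assoc (_ + 1), ← hc]
        exact mul_le_mul_of_nonneg_right (by linarith) hnn

/-- Since the collision frequency is bounded, the loss term of a short explicit Euler step cannot
exceed the data, and the gain term of nonnegative data is nonnegative. -/
theorem euler_step_nonneg [Fact (1 ≤ r)] (H : IsAdmissible l r m B) (M : ℝ) :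
    ∃ h₀ : ℝ, 0 < h₀ ∧ ∀ p ∈ {f : WeightedLp l r | ∀ᵐ k : R3, 0 ≤ f k}, ‖p‖ ≤ M →
      ∀ h ∈ Ioc 0 h₀, p + h • H.collisionField p ∈ {f : WeightedLp l r | ∀ᵐ k : R3, 0 ≤ f k} := by
  set c := (2 * frequencyConst m * B ^ 2).toReal with hc
  have hc0 : 0 ≤ c := ENNReal.toReal_nonneg
  refine ⟨(c * M ^ 2 + 1)⁻¹, by positivity, fun p hp hpM h hh => ?_⟩
  have hp : ∀ᵐ k : R3, 0 ≤ p k := hp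
  change ∀ᵐ k : R3, 0 ≤ (p + h • H.collisionField p : WeightedLp l r) k
  filter_upwards [hp, ae_resonant_of_ae hp, WeightedLp.coe_add_ae p (h • H.collisionField p),
    WeightedLp.coe_smul_ae h (H.collisionField p), H.collisionField_ae p] with k h0 h1 e1 e2 e3
  rw [e1, e2, e3, collision]
  have hgain : 0 ≤ gain p k := by
    rw [gain, resonantIntegral]
    refine mul_nonneg (by norm_num) (integral_nonneg_of_ae ?_)
    filter_upwards [h1] with q hq
    exact mul_nonneg (norm_nonneg _) (mul_nonneg (mul_nonneg hq.2.1 hq.2.2) (add_nonneg h0 hq.1))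
  have hfreq : collisionFrequency p k ≤ c * M ^ 2 + 1 := by
    refine (H.collisionFrequency_le p k).trans ?_
    have : ‖p‖ ^ 2 ≤ M ^ 2 := by gcongr
    have := mul_le_mul_of_nonneg_left this hc0
    linarith
  have hone : h * collisionFrequency p k ≤ 1 := by
    calc h * collisionFrequency p k ≤ h * (c * M ^ 2 + 1) := by
          have := hh.1.le
          gcongr
      _ ≤ (c * M ^ 2 + 1)⁻¹ * (c * M ^ 2 + 1) := by
          have := hh.2
          gcongr
      _ = 1 := inv_mul_cancel₀ (by positivity)
  have : p k + h * (gain p k - p k * collisionFrequency p k) =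
      p k * (1 - h * collisionFrequency p k) + h * gain p k := by ring
  rw [this]
  exact add_nonneg (mul_nonneg h0 (by linarith)) (mul_nonneg hh.1.le hgain)

/-- Strong solutions are the solutions of the integral equation of the collision vector field: the
convergence and integrability requirements hold automatically. -/
theorem isStrongSolution_iff [Fact (1 ≤ r)] (H : IsAdmissible l r m B) {T : ℝ} (hT : 0 ≤ T)
    (f₀ : WeightedLp l r) (f : ℝ → WeightedLp l r) :
    IsStrongSolution T f₀ f ↔ IsIntegralSolution H.collisionField T f₀ f := by
  constructor
  · intro hf
    obtain ⟨c, hc, -, hint⟩ := hf.integral_eq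
    refine ⟨hf.continuousOn, fun t ht => ?_⟩
    rw [hint t ht]
    congr 1
    refine intervalIntegral.integral_congr fun s hs => ?_
    rw [uIcc_of_le ht.1] at hs
    exact WeightedLp.ext_ae
      ((hc s ⟨hs.1, hs.2.trans ht.2⟩).trans (H.collisionField_ae (f s)).symm)
  · intro hf
    obtain ⟨M, hM⟩ := hf.exists_norm_le
    refine ⟨hf.continuousOn, fun s _ => H.collisionConverges (f s), fun s => H.collisionField (f s),
      fun s _ => H.collisionField_ae (f s), ?_, hf.integral_eq⟩
    refine ContinuousOn.intervalIntegrable ?_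
    rw [uIcc_of_le hT]
    exact H.isCubicLipschitz.continuousOn_comp (lipschitzConst_pos l m B).le hf.continuousOn hM

end IsAdmissible

theorem exists_isAdmissible {r : ℝ≥0∞} (hr : 2 ≤ r) {δ : ℝ} (hδ : 0 < δ) :
    ∃ B : ℝ≥0∞, IsAdmissible (weightExponent r δ) r (1 / 2 + δ / 2) B := by
  obtain ⟨B, hB, hle⟩ := exists_weightedL2_le hr hδ
  refine ⟨B, one_le_two.trans hr, ?_, by linarith, hB, hle⟩
  have h2 : (r⁻¹).toReal ≤ 1 / 2 := by
    have := ENNReal.toReal_mono (by norm_num) (ENNReal.inv_le_inv.2 hr)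
    simpa using this
  unfold weightExponent
  linarith

end WKE

end

theorem theorem1p1 (r : ℝ≥0∞) [Fact (1 ≤ r)] (hr : 2 ≤ r) (δ : ℝ) (hδ : 0 < δ)
    (hδr : r ≠ ∞ → δ < 1 / r.toReal) :
    ∃ T : ℝ → ℝ, (∀ R, 0 ≤ R → 0 < T R) ∧
      -- existence and uniqueness on `[0, T(‖f₀‖)]`
      (∀ f₀ : WKE.WeightedLp (WKE.weightExponent r δ) r,
        ∃ f : ℝ → WKE.WeightedLp (WKE.weightExponent r δ) r,
          WKE.IsStrongSolution (T ‖f₀‖) f₀ f ∧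
          ∀ g : ℝ → WKE.WeightedLp (WKE.weightExponent r δ) r,
            WKE.IsStrongSolution (T ‖f₀‖) f₀ g → EqOn g f (Icc 0 (T ‖f₀‖))) ∧
      -- continuous dependence on the data
      (∀ (f₀ g₀ : WKE.WeightedLp (WKE.weightExponent r δ) r)
        (f g : ℝ → WKE.WeightedLp (WKE.weightExponent r δ) r),
          WKE.IsStrongSolution (T ‖f₀‖) f₀ f → WKE.IsStrongSolution (T ‖g₀‖) g₀ g →
          ∀ t ∈ Icc 0 (min (T ‖f₀‖) (T ‖g₀‖)), ‖f t - g t‖ ≤ 2 * ‖f₀ - g₀‖) ∧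
      -- preservation of nonnegativity
      (∀ (f₀ : WKE.WeightedLp (WKE.weightExponent r δ) r)
        (f : ℝ → WKE.WeightedLp (WKE.weightExponent r δ) r),
          WKE.IsStrongSolution (T ‖f₀‖) f₀ f → (∀ᵐ k : WKE.R3, 0 ≤ f₀ k) →
          ∀ t ∈ Icc 0 (T ‖f₀‖), ∀ᵐ k : WKE.R3, 0 ≤ f t k) := by
  obtain ⟨B, H⟩ := WKE.exists_isAdmissible hr hδ
  set l := WKE.weightExponent r δ
  set A := WKE.IsAdmissible.lipschitzConst l (1 / 2 + δ / 2) B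
  have hA : 0 < A := WKE.IsAdmissible.lipschitzConst_pos _ _ _
  have hC := H.isCubicLipschitz
  have h0 := H.collisionField_zero
  have hiff : ∀ (f₀ : WKE.WeightedLp l r) (f : ℝ → WKE.WeightedLp l r),
      WKE.IsStrongSolution (WKE.existenceTime A ‖f₀‖) f₀ f ↔
        WKE.IsIntegralSolution H.collisionField (WKE.existenceTime A ‖f₀‖) f₀ f :=
    fun f₀ f => H.isStrongSolution_iff (WKE.existenceTime_pos hA _).le f₀ f
  refine ⟨WKE.existenceTime A, fun R _ => WKE.existenceTime_pos hA R, fun f₀ => ?_,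
    fun f₀ g₀ f g hf hg t ht => ?_, fun f₀ f hf hf₀ t ht => ?_⟩
  · obtain ⟨f, hf, -⟩ := WKE.exists_isIntegralSolution hC h0 hA f₀
    exact ⟨f, (hiff f₀ f).2 hf, fun g hg => ((hiff f₀ g).1 hg).unique hC hA.le hf⟩
  · exact ((hiff f₀ f).1 hf).norm_sub_le_two_mul hC h0 hA ((hiff g₀ g).1 hg) ht
  · refine ((hiff f₀ f).1 hf).mem_of_euler_step_mem hC hA.le WKE.WeightedLp.isClosed_nonneg ?_
      H.euler_step_nonneg hf₀ t ht
    filter_upwards [AEEqFun.coeFn_zero (α := WKE.R3) (β := ℝ) (μ := volume)] with k hk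
    exact hk.ge
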